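/- **Setting.** Fix $g>0$. On the table $\mathcal Q=\{(\theta,y): y\ge|\sin\theta|\}$ consider a point moving with $\ddot\theta=0$, $\ddot y=-g$ between collisions and reflecting elastically (mirror law) at $\partial\mathcal Q$, with energy $E=\tfrac12\dot\theta^2+\tfrac12\dot y^2+gy$. A collision at a non-corner boundary point ($\sin\theta\ne0$) with incoming velocity satisfying $\dot y<0$ is recorded by $(\theta,\dot\theta)$: the foot point is $(\theta,|\sin\theta|)$ and the incoming velocity is $\big(\dot\theta,-\sqrt{2E-2g|\sin\theta|-\dot\theta^2}\big)$. These points form the phase space $\mathcal P_d$; $f(\theta,\dot\theta)=(\theta_1,\dot\theta_1)$ denotes the data (just before the collision) of the next collision. Write $\dot\theta_+(\theta,\dot\theta)$ for the $\theta$-component of the velocity right after the reflection. For $k>0$ put $a=\big(\tfrac\pi2-\tfrac kE,\tfrac{\sqrt2k}{\sqrt E}\big)$ and $$A(E,k)=\frac2g\,\dot\theta_+(a)\sqrt{2E-2g\big|\sin\big(\tfrac\pi2-\tfrac kE\big)\big|-\dot\theta_+(a)^2}+\pi ,$$ $$D_L=\Big\{(\theta,\dot\theta)\in\mathcal P_d:\big|\theta-\tfrac\pi2\big|\le\tfrac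 kE,\ |\dot\theta|\le\tfrac{\sqrt2k}{\sqrt E}\Big\},\qquad D_R=\Big\{(\theta,\dot\theta)\in\mathcal P_d:\big|\theta-\tfrac{3\pi}2\big|\le\tfrac kE,\ |\dot\theta|\le\tfrac{\sqrt2k}{\sqrt E}\Big\}.$$ Tildes denote the objects obtained by identifying $\theta\sim\theta+2\pi$, and $\widetilde D=\widetilde D_L\cup\widetilde D_R$. On the cylinder, let $H_{R_1},H_{L_2},H_{R_3}$ be the projections of $f(D_L)\cap D_R$, $f(D_L)\cap D_L$, $f(D_L)\cap(D_R-(2\pi,0))$, and let $H_{L_1},H_{R_2},H_{L_3}$ be the projections of $f(D_R)\cap(D_L+(2\pi,0))$, $f(D_R)\cap D_R$, $f(D_R)\cap D_L$. In a rectangle $[X_0,X_1]\times[Y_0,Y_1]$ a $\mu$-horizontal strip is a set $\{X\in[X_0,X_1],\ h_1(X)\le Y\le h_2(X)\}$ with $h_1<h_2$ two $\mu$-Lipschitz functions $[X_0,X_1]\to[Y_0,Y_1]$; a $\mu$-vertical strip is a set $\{Y\in[Y_0,Y_1],\ v_1(Y)\le X\le v_2(Y)\}$ with $v_1<v_2$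 two $\mu$-Lipschitz functions $[Y_0,Y_1]\to[X_0,X_1]$. **Proposition 5.2.** For all sufficiently large $E$ there is $k\in\big(\tfrac{g\pi}8,\tfrac{g\pi}2\big)$ with $A(E,k)=0$. Moreover, for all constants $k_1,k_2$ with $k_1>0$ there are constants $C,E_0>0$, depending only on $g,k_1,k_2$, such that for every $E\ge E_0$ and every $k\in(k_1,k_2)$ with $A(E,k)=0$ the following holds. 1. $\tilde f(\widetilde D)\cap\widetilde D$ is the union of the six pairwise disjoint sets $H_s$, $s\in\{L_1,L_2,L_3,R_1,R_2,R_3\}$, where $H_{L_i}$ is a $\mu_h$-horizontal strip in $\widetilde D_L$ and $H_{R_i}$ is a $\mu_h$-horizontal strip in $\widetilde D_R$, with $\mu_h=C/\sqrt E$. 2. The preimages $V_s=\{q\in\widetilde{\mathcal P}_d:\tilde f(q)\in H_s\}$ are six pairwise disjoint subsets of $\widetilde D$; $V_{R_1},V_{L_2},V_{R_3}$ are $\mu_v$-vertical strips in $\widetilde D_L$ and $V_{L_1},V_{R_2},V_{L_3}$ are $\mu_v$-vertical strips in $\widetilde D_R$, with $\mu_v=C/\sqrt E$. -/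

import Mathlib

open Set Real

noncomputable section

namespace BouncingCoin

/-! ### Strips in a rectangle `[X₀, X₁] × [Y₀, Y₁]` -/

/-- The graph `Y = h X` is a `μ`-horizontal curve in `[X₀, X₁] × [Y₀, Y₁]`. -/
def IsHorizontalCurve (X₀ X₁ Y₀ Y₁ μ : ℝ) (h : ℝ → ℝ) : Prop :=
  0 ≤ μ ∧ (∀ X ∈ Icc X₀ X₁, h X ∈ Icc Y₀ Y₁) ∧
    ∀ X ∈ Icc X₀ X₁, ∀ X' ∈ Icc X₀ X₁, |h X - h X'| ≤ μ * |X - X'|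

/-- The graph `X = v Y` is a `μ`-vertical curve in `[X₀, X₁] × [Y₀, Y₁]`. -/
def IsVerticalCurve (X₀ X₁ Y₀ Y₁ μ : ℝ) (v : ℝ → ℝ) : Prop :=
  0 ≤ μ ∧ (∀ Y ∈ Icc Y₀ Y₁, v Y ∈ Icc X₀ X₁) ∧
    ∀ Y ∈ Icc Y₀ Y₁, ∀ Y' ∈ Icc Y₀ Y₁, |v Y - v Y'| ≤ μ * |Y - Y'|

/-- `H` is a `μ`-horizontal strip in `[X₀, X₁] × [Y₀, Y₁]`: the closed region between two
non-intersecting `μ`-horizontal curves. -/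
def IsHorizontalStrip (X₀ X₁ Y₀ Y₁ μ : ℝ) (H : Set (ℝ × ℝ)) : Prop :=
  ∃ h₁ h₂ : ℝ → ℝ, IsHorizontalCurve X₀ X₁ Y₀ Y₁ μ h₁ ∧ IsHorizontalCurve X₀ X₁ Y₀ Y₁ μ h₂ ∧
    (∀ X ∈ Icc X₀ X₁, h₁ X < h₂ X) ∧
    H = {p | p.1 ∈ Icc X₀ X₁ ∧ p.2 ∈ Icc (h₁ p.1) (h₂ p.1)}

/-- `V` is a `μ`-vertical strip in `[X₀, X₁] × [Y₀, Y₁]`: the closed region between two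
non-intersecting `μ`-vertical curves. -/
def IsVerticalStrip (X₀ X₁ Y₀ Y₁ μ : ℝ) (V : Set (ℝ × ℝ)) : Prop :=
  ∃ v₁ v₂ : ℝ → ℝ, IsVerticalCurve X₀ X₁ Y₀ Y₁ μ v₁ ∧ IsVerticalCurve X₀ X₁ Y₀ Y₁ μ v₂ ∧
    (∀ Y ∈ Icc Y₀ Y₁, v₁ Y < v₂ Y) ∧
    V = {p | p.2 ∈ Icc Y₀ Y₁ ∧ p.1 ∈ Icc (v₁ p.2) (v₂ p.2)}

/-! ### The coin billiard

The table is `{(θ, y) | |sin θ| ≤ y}`; between collisions `θ'' = 0`, `y'' = -g`; the energy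
`θ'² / 2 + y'² / 2 + g y = E` is conserved. A collision is recorded just before it happens, by the
coordinates `p = (θ, θ')`: the foot point is `(θ, |sin θ|)` and `y' < 0` is given by the energy. -/

/-- The vertical component `y' = -√(2E - 2g|sin θ| - θ'²)` of the incoming velocity. -/
def vyIn (g E : ℝ) (p : ℝ × ℝ) : ℝ :=
  -√(2 * E - 2 * g * |sin p.1| - p.2 ^ 2)

/-- The component `θ'` of the velocity after the mirror reflection in the normal
`(-cos θ · sin θ / |sin θ|, 1)` of the boundary. -/
def vθOut (g E : ℝ) (p : ℝ × ℝ) : ℝ :=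
  (sin p.1 ^ 2 * p.2 + 2 * cos p.1 * (sin p.1 / |sin p.1|) * vyIn g E p) / (1 + cos p.1 ^ 2)

/-- The component `y'` of the velocity after the mirror reflection. -/
def vyOut (g E : ℝ) (p : ℝ × ℝ) : ℝ :=
  (2 * cos p.1 * (sin p.1 / |sin p.1|) * p.2 - sin p.1 ^ 2 * vyIn g E p) / (1 + cos p.1 ^ 2)

/-- The phase points in the coordinates `(θ, θ')`: the foot point is not a corner of the table,
and the velocity `(θ', y')` has energy `E`, satisfies `y' < 0`, and is incoming
(negative product with the inner normal). -/
def phaseSpace (g E : ℝ) : Set (ℝ × ℝ) :=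
  {p | sin p.1 ≠ 0 ∧ 0 < 2 * E - 2 * g * |sin p.1| - p.2 ^ 2 ∧
    -(cos p.1 * (sin p.1 / |sin p.1|)) * p.2 + vyIn g E p < 0}

/-- The coordinate `θ` at time `t` after the collision `p`, along the free parabolic flight. -/
def flightθ (g E : ℝ) (p : ℝ × ℝ) (t : ℝ) : ℝ :=
  p.1 + vθOut g E p * t

/-- The coordinate `y` at time `t` after the collision `p`, along the free parabolic flight. -/
def flightY (g E : ℝ) (p : ℝ × ℝ) (t : ℝ) : ℝ :=
  |sin p.1| + vyOut g E p * t - g * t ^ 2 / 2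

/-- The time from the collision `p` to the next one: the first positive time at which the flight
meets the boundary `y = |sin θ|`. -/
def flightTime (g E : ℝ) (p : ℝ × ℝ) : ℝ :=
  sInf {t : ℝ | 0 < t ∧ flightY g E p t = |sin (flightθ g E p t)|}

/-- The return map `f`, with `θ` in `ℝ`: from a collision to the next one
(`θ'` is constant during the flight). It is meaningful at the points of `phaseSpace g E`. -/
def returnMap (g E : ℝ) (p : ℝ × ℝ) : ℝ × ℝ :=
  (flightθ g E p (flightTime g E p), vθOut g E p)

/-! ### The cylinder `θ ∼ θ + 2π` -/

/-- The projection to the cylinder. -/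
def proj (p : ℝ × ℝ) : Real.Angle × ℝ := ((p.1 : Real.Angle), p.2)

/-- The phase points on the cylinder. -/
def phaseSpaceCyl (g E : ℝ) : Set (Real.Angle × ℝ) := proj '' phaseSpace g E

/-- The return map `f̃` on the cylinder, induced by `returnMap` (see `returnMapCyl_proj`). -/
def returnMapCyl (g E : ℝ) (q : Real.Angle × ℝ) : Real.Angle × ℝ :=
  proj (returnMap g E (q.1.toReal, q.2))

theorem returnMap_add_int (g E θ ω : ℝ) (n : ℤ) :
    returnMap g E (θ + n * (2 * π), ω) =
      ((returnMap g E (θ, ω)).1 + n * (2 * π), (returnMap g E (θ, ω)).2) := by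
  have hI : vyIn g E (θ + n * (2 * π), ω) = vyIn g E (θ, ω) := by
    simp [vyIn, Real.sin_add_int_mul_two_pi]
  have hθ : vθOut g E (θ + n * (2 * π), ω) = vθOut g E (θ, ω) := by
    simp [vθOut, hI, Real.sin_add_int_mul_two_pi, Real.cos_add_int_mul_two_pi]
  have hy : vyOut g E (θ + n * (2 * π), ω) = vyOut g E (θ, ω) := by
    simp [vyOut, hI, Real.sin_add_int_mul_two_pi, Real.cos_add_int_mul_two_pi]
  have hfθ : ∀ t, flightθ g E (θ + n * (2 * π), ω) t =
      flightθ g E (θ, ω) t + n * (2 * π) := by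
    intro t
    simp only [flightθ, hθ]
    ring
  have hfy : ∀ t, flightY g E (θ + n * (2 * π), ω) t = flightY g E (θ, ω) t := by
    intro t
    simp [flightY, hy, Real.sin_add_int_mul_two_pi]
  have hT : flightTime g E (θ + n * (2 * π), ω) = flightTime g E (θ, ω) := by
    simp only [flightTime, hfθ, hfy, Real.sin_add_int_mul_two_pi]
  simp only [returnMap, hT, hfθ, hθ]

/-- `f̃` is well defined: it is the map induced by `f`. -/
theorem returnMapCyl_proj (g E : ℝ) (p : ℝ × ℝ) :
    returnMapCyl g E (proj p) = proj (returnMap g E p) := by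
  obtain ⟨θ, ω⟩ := p
  have h : (((θ : Real.Angle).toReal : ℝ) : Real.Angle) = (θ : Real.Angle) :=
    Real.Angle.coe_toReal _
  obtain ⟨n, hn⟩ := Real.Angle.angle_eq_iff_two_pi_dvd_sub.1 h
  have h2 : (θ : Real.Angle).toReal = θ + n * (2 * π) := by linarith
  simp only [returnMapCyl, proj, h2, returnMap_add_int]
  simp

/-! ### The rectangles and the strips -/

/-- The equation `cornerEq g E k = 0` selects the size `k = k(E)` of the rectangles: the flight that
starts from the collision `a = (π/2 - k/E, √2 k/√E)` has come back to its initial height when `θ`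
has changed by `-π`. -/
def cornerEq (g E k : ℝ) : ℝ :=
  let a : ℝ × ℝ := (π / 2 - k / E, √2 * k / √E)
  2 / g * (vθOut g E a * √(2 * E - 2 * g * |sin a.1| - vθOut g E a ^ 2)) + π

/-- The colliding mass. -/
inductive Side
  | L
  | R

/-- The abscissa of the centre of the rectangle. -/
def Side.center : Side → ℝ
  | .L => π / 2
  | .R => 3 * π / 2

/-- The rectangles `D_L` and `D_R`. -/
def rect (g E k : ℝ) (σ : Side) : Set (ℝ × ℝ) :=
  {p | p ∈ phaseSpace g E ∧ |p.1 - σ.center| ≤ k / E ∧ |p.2| ≤ √2 * k / √E}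

/-- The rectangles `D̃_L` and `D̃_R` on the cylinder. -/
def rectCyl (g E k : ℝ) (σ : Side) : Set (Real.Angle × ℝ) := proj '' rect g E k σ

/-- The domain `D̃ = D̃_L ∪ D̃_R`. -/
def domainCyl (g E k : ℝ) : Set (Real.Angle × ℝ) := rectCyl g E k .L ∪ rectCyl g E k .R

/-- A set on the cylinder is a `μ`-horizontal strip in the rectangle of side `σ`. -/
def IsHorizontalStripIn (E k : ℝ) (σ : Side) (μ : ℝ) (S : Set (Real.Angle × ℝ)) : Prop :=
  ∃ H : Set (ℝ × ℝ), IsHorizontalStrip (σ.center - k / E) (σ.center + k / E)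
    (-(√2 * k / √E)) (√2 * k / √E) μ H ∧ S = proj '' H

/-- A set on the cylinder is a `μ`-vertical strip in the rectangle of side `σ`. -/
def IsVerticalStripIn (E k : ℝ) (σ : Side) (μ : ℝ) (S : Set (Real.Angle × ℝ)) : Prop :=
  ∃ V : Set (ℝ × ℝ), IsVerticalStrip (σ.center - k / E) (σ.center + k / E)
    (-(√2 * k / √E)) (√2 * k / √E) μ V ∧ S = proj '' V

/-- The six labels. -/
inductive Label
  | L1
  | L2
  | L3
  | R1
  | R2
  | R3

/-- The rectangle that contains the strip `H_s`. -/
def Label.target : Label → Side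
  | .L1 => .L
  | .L2 => .L
  | .L3 => .L
  | .R1 => .R
  | .R2 => .R
  | .R3 => .R

/-- The rectangle whose image contains the strip `H_s`. -/
def Label.source : Label → Side
  | .R1 => .L
  | .L2 => .L
  | .R3 => .L
  | .L1 => .R
  | .R2 => .R
  | .L3 => .R

/-- The integer `n` such that `H_s` comes from the overlap with the target rectangle
translated by `(2πn, 0)`. -/
def Label.shift : Label → ℤ
  | .L1 => 1
  | .L2 => 0
  | .L3 => 0
  | .R1 => 0
  | .R2 => 0
  | .R3 => -1

/-- The set `H_s`: the overlap of `f(D_source)` with `D_target + (2πn, 0)`, on the cylinder. -/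
def stripH (g E k : ℝ) (s : Label) : Set (Real.Angle × ℝ) :=
  proj '' {p | p ∈ returnMap g E '' rect g E k s.source ∧
    (p.1 - 2 * π * s.shift, p.2) ∈ rect g E k s.target}

/-- The set `V_s`: the preimage of `H_s` under `f̃` in the phase space. -/
def stripV (g E k : ℝ) (s : Label) : Set (Real.Angle × ℝ) :=
  {q | q ∈ phaseSpaceCyl g E ∧ returnMapCyl g E q ∈ stripH g E k s}

end BouncingCoin

end

/-! At high energy the rectangles lie close to the tops `θ = π/2 + mπ` of the boundary. Their
half-width is `ε = k/E` and their half-height is `W = √2 k/√E = ε √(2E)`. Let `u` be the deviation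
from a top. A bounce at `u` rotates the (time-reversed) velocity by an angle whose half has tangent
`sin u`, which gives the outgoing horizontal velocity `kick`. A flight from `u` to a point `v` near
another top lasts `1/g` times the sum of the vertical speeds at both ends, which gives the equation
`IsFlight`, with `ν` counting the coins between the two tops.

The map is not estimated directly but in the mixed coordinates `(u, v)` of two successive
collisions. For fixed `ν` the flight equation determines the horizontal velocity `w(u, v)`, and
reversibility of the bounce gives the incoming velocity `Ω(u, v) = kick (-u) w`; the map is `(u, Ω)
↦ (v, w)`. Since the flight time is of order `√E/g`, `w` is Lipschitz with constant `g/√E`. Since a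
bounce at `u` changes the horizontal velocity by about `2u√(2E)`, `Ω` decreases in `u` with slope at
least `√E/2`. `exists_strips` converts these two facts into strips: the edges of `H` are the curves
`Ω = ±W`, those of `V` are the curves `v = ±ε`.

The corner equation makes the strips cross the rectangles completely. It says that the corner `(-ε,
W)` is sent to `v = -ε` with `ν = -1`; by monotonicity every flight from `-ε` with `ν ≥ -1` needs `Ω
≥ W`, and symmetrically at `ε` (`le_kick_of_flight`, `kick_le_of_flight`). It also makes `W` large
enough for all flights with `|ν| ≤ 1` (`reach`) and too small for `|ν| ≥ 2` (`abs_disp_le`), so that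
two sources and three values of `ν` give six strips.

`returnMap_eq_iff` identifies this model with the billiard. As the preimages are taken in the whole
phase space, injectivity at steep landings is also needed; `returnMap_injective` proves it by
running the flight backwards. -/

noncomputable section

namespace BouncingCoin

/-! ### Strips cut out by a map in mixed coordinates -/

/-- Let a planar map send `(u, Ω u v)` to `(v, w u v)`. If `Ω` is steeply decreasing in `u` and `w`
is `L`-Lipschitz, the image of the rectangle meets the rectangle in a horizontal strip and the
preimage is a vertical strip. -/
theorem exists_strips {ε W L m μ : ℝ} (hε : 0 < ε) (hW : 0 < W) (hL : 0 ≤ L) (hm : 0 < m)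
    (hLμ : 2 * L ≤ μ) (hmμ : 1 ≤ m * μ) {w Ω : ℝ → ℝ → ℝ}
    (hw : ∀ u ∈ Icc (-ε) ε, ∀ v ∈ Icc (-ε) ε, w u v ∈ Icc (-W) W)
    (hwu : ∀ u ∈ Icc (-ε) ε, ∀ u' ∈ Icc (-ε) ε, ∀ v ∈ Icc (-ε) ε, u' < u →
      0 < w u' v - w u v ∧ w u' v - w u v ≤ L * (u - u'))
    (hwv : ∀ u ∈ Icc (-ε) ε, ∀ v ∈ Icc (-ε) ε, ∀ v' ∈ Icc (-ε) ε,
      |w u v - w u v'| ≤ L * |v - v'|)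
    (hΩu : ∀ u ∈ Icc (-ε) ε, ∀ u' ∈ Icc (-ε) ε, ∀ v ∈ Icc (-ε) ε, u' < u →
      m * (u - u') ≤ Ω u' v - Ω u v)
    (hΩc : ∀ v ∈ Icc (-ε) ε, ContinuousOn (fun u => Ω u v) (Icc (-ε) ε))
    (hΩv : ∀ u ∈ Icc (-ε) ε, ∀ v ∈ Icc (-ε) ε, ∀ v' ∈ Icc (-ε) ε, v' < v →
      0 < Ω u v - Ω u v' ∧ Ω u v - Ω u v' ≤ m * (v - v'))
    (hlo : ∀ v ∈ Icc (-ε) ε, W ≤ Ω (-ε) v) (hhi : ∀ v ∈ Icc (-ε) ε, Ω ε v ≤ -W) :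
    IsHorizontalStrip (-ε) ε (-W) W μ
      {p | p.1 ∈ Icc (-ε) ε ∧ ∃ u ∈ Icc (-ε) ε, Ω u p.1 ∈ Icc (-W) W ∧ w u p.1 = p.2} ∧
    IsVerticalStrip (-ε) ε (-W) W μ
      {p | p.1 ∈ Icc (-ε) ε ∧ p.2 ∈ Icc (-W) W ∧ ∃ v ∈ Icc (-ε) ε, Ω p.1 v = p.2} := by
  have hμ : 0 ≤ μ := by linarith
  have hne : -ε ≤ ε := by linarith
  -- The membership conditions stand inside the existential so that `choose` yields a total function
  -- `U`; its value 0 outside the rectangle is never used.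
  have hex : ∀ v ω, ∃ u, v ∈ Icc (-ε) ε → ω ∈ Icc (-W) W → u ∈ Icc (-ε) ε ∧ Ω u v = ω := by
    intro v ω
    by_cases hv : v ∈ Icc (-ε) ε
    · by_cases hω : ω ∈ Icc (-W) W
      · have := intermediate_value_Icc' hne (hΩc v hv)
        obtain ⟨u, hu, h⟩ := this ⟨(hhi v hv).trans hω.1, hω.2.trans (hlo v hv)⟩
        exact ⟨u, fun _ _ => ⟨hu, h⟩⟩
      · exact ⟨0, fun _ h => absurd h hω⟩
    · exact ⟨0, fun h => absurd h hv⟩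
  choose U hU using hex
  have hUm : ∀ v ∈ Icc (-ε) ε, ∀ ω ∈ Icc (-W) W, U v ω ∈ Icc (-ε) ε :=
    fun v hv ω hω => (hU v ω hv hω).1
  have hUe : ∀ v ∈ Icc (-ε) ε, ∀ ω ∈ Icc (-W) W, Ω (U v ω) v = ω :=
    fun v hv ω hω => (hU v ω hv hω).2
  have hanti : ∀ u ∈ Icc (-ε) ε, ∀ u' ∈ Icc (-ε) ε, ∀ v ∈ Icc (-ε) ε,
      Ω u v ≤ Ω u' v → u' ≤ u := by
    intro u hu u' hu' v hv h
    by_contra hlt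
    push Not at hlt
    have := hΩu u' hu' u hu v hv hlt
    have : 0 < m * (u' - u) := mul_pos hm (by linarith)
    linarith
  have habs : ∀ u ∈ Icc (-ε) ε, ∀ u' ∈ Icc (-ε) ε, ∀ v ∈ Icc (-ε) ε,
      m * |u - u'| ≤ |Ω u v - Ω u' v| := by
    intro u hu u' hu' v hv
    rcases lt_trichotomy u u' with h | h | h
    · have := hΩu u' hu' u hu v hv h
      rw [abs_of_neg (by linarith : u - u' < 0)]
      exact le_trans (by linarith) (le_abs_self _)
    · subst h; simp
    · have := hΩu u hu u' hu' v hv h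
      rw [abs_of_pos (by linarith : 0 < u - u')]
      exact le_trans (by linarith) (neg_le_abs _)
  have hwabs : ∀ u ∈ Icc (-ε) ε, ∀ u' ∈ Icc (-ε) ε, ∀ v ∈ Icc (-ε) ε,
      |w u v - w u' v| ≤ L * |u - u'| := by
    intro u hu u' hu' v hv
    rcases lt_trichotomy u u' with h | h | h
    · have := hwu u' hu' u hu v hv h
      rw [abs_of_neg (by linarith : u - u' < 0), abs_of_pos this.1]
      linarith [this.2]
    · subst h; simp
    · have := hwu u hu u' hu' v hv h
      rw [abs_of_pos (by linarith : 0 < u - u'), abs_of_neg (by linarith [this.1])]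
      linarith [this.2]
  have hΩvabs : ∀ u ∈ Icc (-ε) ε, ∀ v ∈ Icc (-ε) ε, ∀ v' ∈ Icc (-ε) ε,
      |Ω u v - Ω u v'| ≤ m * |v - v'| := by
    intro u hu v hv v' hv'
    rcases lt_trichotomy v v' with h | h | h
    · have := hΩv u hu v' hv' v hv h
      rw [abs_of_neg (by linarith : v - v' < 0), abs_of_neg (by linarith [this.1])]
      linarith [this.2]
    · subst h; simp
    · have := hΩv u hu v hv v' hv' h
      rw [abs_of_pos (by linarith : 0 < v - v'), abs_of_pos this.1]
      linarith [this.2]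
  -- Along a level curve of `Ω` the change due to `u`, at least `m |ΔU|`, balances the change due to
  -- `v`, at most `m |v - v'|`.
  have hUv : ∀ v ∈ Icc (-ε) ε, ∀ v' ∈ Icc (-ε) ε, ∀ ω ∈ Icc (-W) W,
      |U v ω - U v' ω| ≤ |v - v'| := by
    intro v hv v' hv' ω hω
    have h1 := habs _ (hUm v hv ω hω) _ (hUm v' hv' ω hω) v hv
    have h2 := hΩvabs _ (hUm v' hv' ω hω) v' hv' v hv
    rw [hUe v hv ω hω] at h1
    rw [hUe v' hv' ω hω, abs_sub_comm v' v] at h2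
    exact le_of_mul_le_mul_left (h1.trans h2) hm
  have hUω : ∀ v ∈ Icc (-ε) ε, ∀ ω ∈ Icc (-W) W, ∀ ω' ∈ Icc (-W) W,
      |U v ω - U v ω'| ≤ μ * |ω - ω'| := by
    intro v hv ω hω ω' hω'
    have h1 := habs _ (hUm v hv ω hω) _ (hUm v hv ω' hω') v hv
    rw [hUe v hv ω hω, hUe v hv ω' hω'] at h1
    have h2 := mul_le_mul_of_nonneg_right hmμ (abs_nonneg (U v ω - U v ω'))
    have h3 := mul_le_mul_of_nonneg_left h1 hμ
    nlinarith
  -- One `L` comes from the motion of `U`, which is 1-Lipschitz in `v`, and one from `v` itself;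
  -- hence the condition `2 * L ≤ μ`.
  have hcurve : ∀ ω ∈ Icc (-W) W,
      IsHorizontalCurve (-ε) ε (-W) W μ (fun v => w (U v ω) v) := by
    intro ω hω
    refine ⟨hμ, fun v hv => hw _ (hUm v hv ω hω) v hv, fun v hv v' hv' => ?_⟩
    have h1 := hwabs _ (hUm v hv ω hω) _ (hUm v' hv' ω hω) v hv
    have h2 := hwv _ (hUm v' hv' ω hω) v hv v' hv'
    have h3 := mul_le_mul_of_nonneg_left (hUv v hv v' hv' ω hω) hL
    have h4 := abs_sub_le (w (U v ω) v) (w (U v' ω) v) (w (U v' ω) v')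
    have h5 := mul_le_mul_of_nonneg_right hLμ (abs_nonneg (v - v'))
    simp only
    linarith
  have hWm : W ∈ Icc (-W) W := ⟨by linarith, le_rfl⟩
  have hWm' : -W ∈ Icc (-W) W := ⟨le_rfl, by linarith⟩
  have hεm : ε ∈ Icc (-ε) ε := ⟨by linarith, le_rfl⟩
  have hεm' : -ε ∈ Icc (-ε) ε := ⟨le_rfl, by linarith⟩
  have hwmono : ∀ u ∈ Icc (-ε) ε, ∀ u' ∈ Icc (-ε) ε, ∀ v ∈ Icc (-ε) ε, u' ≤ u →
      w u v ≤ w u' v := by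
    intro u hu u' hu' v hv h
    rcases h.lt_or_eq with h | h
    · linarith [(hwu u hu u' hu' v hv h).1]
    · rw [h]
  -- Both `Ω` and `w` decrease in `u`, so `w (U v ω) v` increases with `ω`: `-W` gives the lower
  -- curve. As `Ω` increases in `v`, so does `U`: `-ε` gives the left curve.
  refine ⟨⟨fun v => w (U v (-W)) v, fun v => w (U v W) v, hcurve _ hWm', hcurve _ hWm, ?_, ?_⟩,
    ⟨U (-ε), U ε, ?_, ?_, ?_, ?_⟩⟩
  · intro v hv
    have hle := hanti _ (hUm v hv _ hWm') _ (hUm v hv _ hWm) v hv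
      (by rw [hUe v hv _ hWm, hUe v hv _ hWm']; linarith)
    have hne' : U v W ≠ U v (-W) := by
      intro h
      have h1 := hUe v hv _ hWm
      rw [h, hUe v hv _ hWm'] at h1
      linarith
    linarith [(hwu _ (hUm v hv _ hWm') _ (hUm v hv _ hWm) v hv (lt_of_le_of_ne hle hne')).1]
  · ext ⟨v, y⟩
    simp only [mem_ofPred_eq]
    refine and_congr_right fun hv => ⟨?_, ?_⟩
    · rintro ⟨u, hu, hΩ, rfl⟩
      refine ⟨hwmono _ (hUm v hv _ hWm') _ hu v hv ?_, hwmono _ hu _ (hUm v hv _ hWm) v hv ?_⟩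
      · exact hanti _ (hUm v hv _ hWm') _ hu v hv (by rw [hUe v hv _ hWm']; exact hΩ.1)
      · exact hanti _ hu _ (hUm v hv _ hWm) v hv (by rw [hUe v hv _ hWm]; exact hΩ.2)
    · intro hy
      have hle := hanti _ (hUm v hv _ hWm') _ (hUm v hv _ hWm) v hv
        (by rw [hUe v hv _ hWm, hUe v hv _ hWm']; linarith)
      have hsub : Icc (U v W) (U v (-W)) ⊆ Icc (-ε) ε :=
        Icc_subset_Icc (hUm v hv _ hWm).1 (hUm v hv _ hWm').2
      have hcont : ContinuousOn (fun u => w u v) (Icc (-ε) ε) := by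
        have : LipschitzOnWith L.toNNReal (fun u => w u v) (Icc (-ε) ε) := by
          refine LipschitzOnWith.of_dist_le_mul fun a ha b hb => ?_
          rw [Real.dist_eq, Real.dist_eq, Real.coe_toNNReal _ hL]
          exact hwabs a ha b hb v hv
        exact this.continuousOn
      obtain ⟨u, hu, h⟩ := intermediate_value_Icc' hle (hcont.mono hsub) hy
      refine ⟨u, hsub hu, ⟨?_, ?_⟩, h⟩
      · by_contra hlt
        push Not at hlt
        have h1 := hanti u (hsub hu) _ (hUm v hv _ hWm') v hv
          (by rw [hUe v hv _ hWm']; exact hlt.le)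
        have h2 : u = U v (-W) := le_antisymm hu.2 h1
        rw [h2, hUe v hv _ hWm'] at hlt
        exact lt_irrefl _ hlt
      · by_contra hlt
        push Not at hlt
        have h1 := hanti _ (hUm v hv _ hWm) u (hsub hu) v hv
          (by rw [hUe v hv _ hWm]; exact hlt.le)
        have h2 : u = U v W := le_antisymm h1 hu.1
        rw [h2, hUe v hv _ hWm] at hlt
        exact lt_irrefl _ hlt
  · exact ⟨hμ, fun ω hω => hUm _ hεm' ω hω, fun ω hω ω' hω' => hUω _ hεm' ω hω ω' hω'⟩
  · exact ⟨hμ, fun ω hω => hUm _ hεm ω hω, fun ω hω ω' hω' => hUω _ hεm ω hω ω' hω'⟩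
  · intro ω hω
    by_contra hlt
    push Not at hlt
    have h1 := (hΩv _ (hUm _ hεm ω hω) ε hεm (-ε) hεm' (by linarith)).1
    rw [hUe _ hεm ω hω] at h1
    have h2 := hanti _ (hUm _ hεm ω hω) _ (hUm _ hεm' ω hω) (-ε) hεm'
      (by rw [hUe _ hεm' ω hω]; linarith)
    have h3 : U (-ε) ω = U ε ω := le_antisymm h2 hlt
    rw [← h3, hUe _ hεm' ω hω] at h1
    exact lt_irrefl _ (by linarith : ω < ω)
  · ext ⟨u, ω⟩
    simp only [mem_ofPred_eq]
    constructor
    · rintro ⟨hu, hω, v, hv, rfl⟩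
      have hΩmono : ∀ v ∈ Icc (-ε) ε, ∀ v' ∈ Icc (-ε) ε, v' ≤ v → Ω u v' ≤ Ω u v := by
        intro v hv v' hv' h
        rcases h.lt_or_eq with h | h
        · linarith [(hΩv u hu v hv v' hv' h).1]
        · rw [h]
      refine ⟨hω, hanti _ hu _ (hUm _ hεm' _ hω) _ hεm' ?_, hanti _ (hUm _ hεm _ hω) _ hu _ hεm ?_⟩
      · rw [hUe _ hεm' _ hω]; exact hΩmono v hv _ hεm' hv.1
      · rw [hUe _ hεm _ hω]; exact hΩmono _ hεm v hv hv.2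
    · rintro ⟨hω, hu1, hu2⟩
      have hu : u ∈ Icc (-ε) ε := ⟨(hUm _ hεm' _ hω).1.trans hu1, hu2.trans (hUm _ hεm _ hω).2⟩
      have hΩle : ∀ v ∈ Icc (-ε) ε, ∀ u ∈ Icc (-ε) ε, ∀ u' ∈ Icc (-ε) ε, u' ≤ u →
          Ω u v ≤ Ω u' v := by
        intro v hv u hu u' hu' h
        rcases h.lt_or_eq with h | h
        · have := hΩu u hu u' hu' v hv h
          have : 0 < m * (u - u') := mul_pos hm (by linarith)
          linarith
        · rw [h]
      have hcont : ContinuousOn (fun v => Ω u v) (Icc (-ε) ε) := by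
        have : LipschitzOnWith m.toNNReal (fun v => Ω u v) (Icc (-ε) ε) := by
          refine LipschitzOnWith.of_dist_le_mul fun a ha b hb => ?_
          rw [Real.dist_eq, Real.dist_eq, Real.coe_toNNReal _ hm.le]
          exact hΩvabs u hu a ha b hb
        exact this.continuousOn
      have h1 := hΩle _ hεm' _ hu _ (hUm _ hεm' _ hω) hu1
      have h2 := hΩle _ hεm _ (hUm _ hεm _ hω) _ hu hu2
      rw [hUe _ hεm' _ hω] at h1
      rw [hUe _ hεm _ hω] at h2
      obtain ⟨v, hv, h⟩ := intermediate_value_Icc hne hcont ⟨h1, h2⟩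
      exact ⟨hu, hω, v, hv, h⟩

theorem IsHorizontalStrip.translate {X₀ X₁ Y₀ Y₁ μ : ℝ} {H : Set (ℝ × ℝ)}
    (h : IsHorizontalStrip X₀ X₁ Y₀ Y₁ μ H) (c : ℝ) :
    IsHorizontalStrip (c + X₀) (c + X₁) Y₀ Y₁ μ {p | (p.1 - c, p.2) ∈ H} := by
  obtain ⟨h₁, h₂, ⟨hμ, m₁, l₁⟩, ⟨-, m₂, l₂⟩, hlt, rfl⟩ := h
  have hs : ∀ X ∈ Icc (c + X₀) (c + X₁), X - c ∈ Icc X₀ X₁ := fun X hX =>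
    ⟨by linarith [hX.1], by linarith [hX.2]⟩
  refine ⟨fun X => h₁ (X - c), fun X => h₂ (X - c), ⟨hμ, fun X hX => m₁ _ (hs X hX), ?_⟩,
    ⟨hμ, fun X hX => m₂ _ (hs X hX), ?_⟩, fun X hX => hlt _ (hs X hX), ?_⟩
  · intro X hX X' hX'
    simpa using l₁ _ (hs X hX) _ (hs X' hX')
  · intro X hX X' hX'
    simpa using l₂ _ (hs X hX) _ (hs X' hX')
  · ext p
    simp only [mem_ofPred_eq, mem_Icc, le_sub_iff_add_le', sub_le_iff_le_add']

theorem IsVerticalStrip.translate {X₀ X₁ Y₀ Y₁ μ : ℝ} {V : Set (ℝ × ℝ)}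
    (h : IsVerticalStrip X₀ X₁ Y₀ Y₁ μ V) (c : ℝ) :
    IsVerticalStrip (c + X₀) (c + X₁) Y₀ Y₁ μ {p | (p.1 - c, p.2) ∈ V} := by
  obtain ⟨v₁, v₂, ⟨hμ, m₁, l₁⟩, ⟨-, m₂, l₂⟩, hlt, rfl⟩ := h
  refine ⟨fun Y => c + v₁ Y, fun Y => c + v₂ Y, ⟨hμ, fun Y hY => ?_, fun Y hY Y' hY' => ?_⟩,
    ⟨hμ, fun Y hY => ?_, fun Y hY Y' hY' => ?_⟩, fun Y hY => by linarith [hlt Y hY], ?_⟩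
  · exact ⟨by linarith [(m₁ Y hY).1], by linarith [(m₁ Y hY).2]⟩
  · simpa using l₁ Y hY Y' hY'
  · exact ⟨by linarith [(m₂ Y hY).1], by linarith [(m₂ Y hY).2]⟩
  · simpa using l₂ Y hY Y' hY'
  · ext p
    simp only [mem_ofPred_eq, mem_Icc, le_sub_iff_add_le', sub_le_iff_le_add']

/-! ### One flight between two neighbourhoods of the tops of the coins

Near the top of a coin we write `θ = π / 2 + m π + u`, so that the height of the coin is `cos u`. -/

/-- The vertical speed at height `cos u` and with horizontal velocity `w`. -/
def speedY (g E u w : ℝ) : ℝ := √(2 * E - 2 * g * cos u - w ^ 2)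

/-- The cosine of the angle of the reflection at `u`. -/
def reflCos (u : ℝ) : ℝ := cos u ^ 2 / (1 + sin u ^ 2)

/-- The sine of the angle of the reflection at `u`. -/
def reflSin (u : ℝ) : ℝ := 2 * sin u / (1 + sin u ^ 2)

/-- The horizontal velocity after the reflection at `u`. -/
def kick (g E u w : ℝ) : ℝ := reflCos u * w + reflSin u * speedY g E u w

/-- The flight from `u` with horizontal velocity `w` lands at `v`, `ν` coins further. -/
def IsFlight (g E ν u v w : ℝ) : Prop :=
  w * (speedY g E u w + speedY g E v w) = g * (ν * π + (v - u))

/-- The regime of high energies, with `ε` and `W` the half-width and the half-height of the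
rectangles. -/
structure HighEnergy (g E ε W : ℝ) : Prop where
  g_pos : 0 < g
  ε_pos : 0 < ε
  one_le : 1 ≤ E
  W_eq : W = ε * √(2 * E)
  g_le : 100 * g ≤ √E
  W_le : 100 * W ≤ 1
  sq_le : 100 * (E * ε ^ 2) ≤ g

/-! ### Symmetry and reversibility of the reflection. -/

theorem reflCos_sq_add_reflSin_sq (u : ℝ) : reflCos u ^ 2 + reflSin u ^ 2 = 1 := by
  have h : 0 < 1 + sin u ^ 2 := by positivity
  have h2 := sin_sq_add_cos_sq u
  have h3 : cos u ^ 2 = 1 - sin u ^ 2 := by linarith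
  rw [reflCos, reflSin, h3]
  field_simp
  ring

theorem reflCos_neg (u : ℝ) : reflCos (-u) = reflCos u := by simp [reflCos]

theorem reflSin_neg (u : ℝ) : reflSin (-u) = -reflSin u := by
  simp [reflSin, neg_div]

theorem speedY_neg_left (g E u w : ℝ) : speedY g E (-u) w = speedY g E u w := by simp [speedY]

theorem speedY_neg_right (g E u w : ℝ) : speedY g E u (-w) = speedY g E u w := by simp [speedY]

/-- Symmetry of the coin about its top; it halves the work at the sides `u = ±ε`. -/
theorem kick_neg_neg (g E u w : ℝ) : kick g E (-u) (-w) = -kick g E u w := by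
  simp only [kick, reflCos_neg, reflSin_neg, speedY_neg_left, speedY_neg_right]
  ring

theorem IsFlight.neg {g E ν u v w : ℝ} (h : IsFlight g E ν u v w) :
    IsFlight g E (-ν) (-u) (-v) (-w) := by
  simp only [IsFlight, speedY_neg_left, speedY_neg_right] at *
  linarith

/-- The vertical speed after the reflection. -/
theorem speedY_kick {g E u w : ℝ} (h₀ : 0 ≤ 2 * E - 2 * g * cos u - w ^ 2)
    (h : 0 ≤ reflCos u * speedY g E u w - reflSin u * w) :
    speedY g E u (kick g E u w) = reflCos u * speedY g E u w - reflSin u * w := by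
  have h1 : speedY g E u w ^ 2 = 2 * E - 2 * g * cos u - w ^ 2 := sq_sqrt h₀
  have h2 := reflCos_sq_add_reflSin_sq u
  have e : 2 * E - 2 * g * cos u - kick g E u w ^ 2 =
      (reflCos u * speedY g E u w - reflSin u * w) ^ 2 := by
    rw [kick]
    linear_combination (-(speedY g E u w ^ 2) - w ^ 2) * h2 - h1
  rw [speedY, e, sqrt_sq h]

/-- The bounce is a rotation of the pair (horizontal velocity, vertical speed), and replacing `u` by
`-u` reverses the angle. This recovers the incoming velocity from the outgoing one. -/
theorem kick_neg_kick {g E u w : ℝ} (h₀ : 0 ≤ 2 * E - 2 * g * cos u - w ^ 2)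
    (h : 0 ≤ reflCos u * speedY g E u w - reflSin u * w) :
    kick g E (-u) (kick g E u w) = w := by
  rw [kick, reflCos_neg, reflSin_neg, speedY_neg_left, speedY_kick h₀ h, kick]
  linear_combination w * reflCos_sq_add_reflSin_sq u

theorem continuous_speedY (g E : ℝ) : Continuous fun p : ℝ × ℝ => speedY g E p.1 p.2 := by
  unfold speedY; fun_prop

theorem continuous_kick (g E : ℝ) : Continuous fun p : ℝ × ℝ => kick g E p.1 p.2 := by
  have h : ∀ x : ℝ, 1 + sin x ^ 2 ≠ 0 := fun x => by positivity
  unfold kick reflCos reflSin speedY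
  fun_prop (disch := intros; exact h _)

/-! #### The reflection at a small angle -/

section smallAngle

variable {u u' : ℝ}

theorem abs_sin_le_of_small (hu : |u| ≤ 1 / 100) : |sin u| ≤ 1 / 100 :=
  abs_sin_le_abs.trans hu

theorem cos_bounds_of_small (hu : |u| ≤ 1 / 100) : 1 - u ^ 2 / 2 ≤ cos u ∧ 99 / 100 ≤ cos u := by
  have h := one_sub_sq_div_two_le_cos (x := u)
  have : u ^ 2 ≤ (1 / 100) ^ 2 :=
    sq_le_sq' (by linarith [abs_le.1 hu]) (by linarith [abs_le.1 hu])
  exact ⟨h, by linarith⟩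

theorem reflCos_bounds (hu : |u| ≤ 1 / 100) :
    1 - 2 * u ^ 2 ≤ reflCos u ∧ 9 / 10 ≤ reflCos u ∧ reflCos u ≤ 1 := by
  have h0 : 0 < 1 + sin u ^ 2 := by positivity
  have h1 : sin u ^ 2 ≤ u ^ 2 := sin_sq_le_sq
  have h2 : u ^ 2 ≤ (1 / 100) ^ 2 :=
    sq_le_sq' (by linarith [abs_le.1 hu]) (by linarith [abs_le.1 hu])
  have h3 : cos u ^ 2 = 1 - sin u ^ 2 := by linarith [sin_sq_add_cos_sq u]
  have h4 : 1 - 2 * u ^ 2 ≤ reflCos u := by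
    rw [reflCos, h3, le_div_iff₀ h0]; nlinarith [sq_nonneg (sin u), sq_nonneg u]
  refine ⟨h4, by linarith, ?_⟩
  rw [reflCos, h3, div_le_one h0]; nlinarith [sq_nonneg (sin u)]

theorem abs_reflSin_le (u : ℝ) : |reflSin u| ≤ 2 * |u| := by
  have h0 : 0 < 1 + sin u ^ 2 := by positivity
  rw [reflSin, abs_div, abs_of_pos h0, div_le_iff₀ h0, abs_mul, abs_two]
  have := abs_sin_le_abs (x := u)
  nlinarith [abs_nonneg u, sq_nonneg (sin u), mul_nonneg (abs_nonneg u) (sq_nonneg (sin u))]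

theorem abs_reflCos_sub_le (hu : |u| ≤ 1 / 100) (hu' : |u'| ≤ 1 / 100) :
    |reflCos u - reflCos u'| ≤ 1 / 10 * |u - u'| := by
  have h0 : 0 < 1 + sin u ^ 2 := by positivity
  have h0' : 0 < 1 + sin u' ^ 2 := by positivity
  have e : reflCos u - reflCos u' =
      -2 * (sin u + sin u') * (sin u - sin u') / ((1 + sin u ^ 2) * (1 + sin u' ^ 2)) := by
    have h3 : cos u ^ 2 = 1 - sin u ^ 2 := by linarith [sin_sq_add_cos_sq u]
    have h3' : cos u' ^ 2 = 1 - sin u' ^ 2 := by linarith [sin_sq_add_cos_sq u']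
    rw [reflCos, reflCos, h3, h3']
    field_simp
    ring
  have h1 : 1 ≤ (1 + sin u ^ 2) * (1 + sin u' ^ 2) := by
    nlinarith [sq_nonneg (sin u), sq_nonneg (sin u'),
      mul_nonneg (sq_nonneg (sin u)) (sq_nonneg (sin u'))]
  rw [e, abs_div, abs_of_pos (by positivity : 0 < (1 + sin u ^ 2) * (1 + sin u' ^ 2)), abs_mul,
    abs_mul]
  refine (div_le_self (by positivity) h1).trans ?_
  have h2 := abs_add_le (sin u) (sin u')
  have h3 := abs_sin_le_of_small hu
  have h4 := abs_sin_le_of_small hu'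
  have h5 := abs_sin_sub_sin_le u u'
  rw [abs_neg, abs_two]
  exact mul_le_mul (by linarith) h5 (abs_nonneg _) (by norm_num)

theorem le_sin_sub_sin (hu : |u| ≤ 1 / 100) (hu' : |u'| ≤ 1 / 100) (h : u' ≤ u) :
    98 / 100 * (u - u') ≤ sin u - sin u' := by
  have hmono : MonotoneOn (fun x => sin x - 98 / 100 * x) (Icc (-(1 / 100)) (1 / 100)) := by
    refine monotoneOn_of_deriv_nonneg (convex_Icc _ _) (by fun_prop) (by fun_prop) fun x hx => ?_
    rw [interior_Icc] at hx
    have hd : HasDerivAt (fun x => sin x - 98 / 100 * x) (cos x - 98 / 100 * 1) x :=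
      (hasDerivAt_sin x).sub ((hasDerivAt_id x).const_mul _)
    rw [hd.deriv]
    have := (cos_bounds_of_small (u := x) (abs_le.2 ⟨hx.1.le, hx.2.le⟩)).2
    linarith
  have := hmono (abs_le.1 hu') (abs_le.1 hu) h
  simp only at this
  linarith

theorem le_reflSin_sub (hu : |u| ≤ 1 / 100) (hu' : |u'| ≤ 1 / 100) (h : u' ≤ u) :
    19 / 10 * (u - u') ≤ reflSin u - reflSin u' := by
  have h0 : 0 < 1 + sin u ^ 2 := by positivity
  have h0' : 0 < 1 + sin u' ^ 2 := by positivity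
  have e : reflSin u - reflSin u' =
      2 * (1 - sin u * sin u') * (sin u - sin u') / ((1 + sin u ^ 2) * (1 + sin u' ^ 2)) := by
    rw [reflSin, reflSin]
    field_simp
    ring
  have h1 := le_sin_sub_sin hu hu' h
  have h3 := abs_le.1 (abs_sin_le_of_small hu)
  have h4 := abs_le.1 (abs_sin_le_of_small hu')
  have h5 : sin u * sin u' ≤ 1 / 100 := by nlinarith
  have h6 : sin u ^ 2 ≤ 1 / 1000 := by nlinarith
  have h7 : sin u' ^ 2 ≤ 1 / 1000 := by nlinarith
  rw [e, le_div_iff₀ (by positivity)]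
  have h8 : (1 + sin u ^ 2) * (1 + sin u' ^ 2) ≤ 101 / 100 := by
    nlinarith [sq_nonneg (sin u), sq_nonneg (sin u')]
  have h9 : 0 ≤ u - u' := by linarith
  have h10 := mul_le_mul_of_nonneg_left h8 h9
  have h11 : 198 / 100 * (sin u - sin u') ≤ 2 * (1 - sin u * sin u') * (sin u - sin u') :=
    mul_le_mul_of_nonneg_right (by linarith) (by linarith)
  linarith

end smallAngle

/-! ### Estimates in the regime of high energies -/

namespace HighEnergy

variable {g E ε W : ℝ}

theorem E_pos (h : HighEnergy g E ε W) : 0 < E := by linarith [h.one_le]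

theorem one_le_sqrt (h : HighEnergy g E ε W) : 1 ≤ √E := Real.one_le_sqrt.2 h.one_le

theorem sq_sqrt_E (h : HighEnergy g E ε W) : √E ^ 2 = E := sq_sqrt h.E_pos.le

theorem sqrt_two_mul (h : HighEnergy g E ε W) : √(2 * E) ^ 2 = 2 * E :=
  sq_sqrt (by linarith [h.E_pos])

theorem sqrt_le_sqrt_two_mul (h : HighEnergy g E ε W) : √E ≤ √(2 * E) :=
  sqrt_le_sqrt (by linarith [h.E_pos])

theorem W_pos (h : HighEnergy g E ε W) : 0 < W := by
  rw [h.W_eq]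
  exact mul_pos h.ε_pos (by linarith [h.one_le_sqrt, h.sqrt_le_sqrt_two_mul])

theorem ε_le_W (h : HighEnergy g E ε W) : ε ≤ W := by
  rw [h.W_eq]
  nlinarith [h.ε_pos, h.one_le_sqrt, h.sqrt_le_sqrt_two_mul]

theorem ε_le (h : HighEnergy g E ε W) : ε ≤ 1 / 100 := by linarith [h.ε_le_W, h.W_le]

theorem W_sq (h : HighEnergy g E ε W) : W ^ 2 = 2 * (E * ε ^ 2) := by
  rw [h.W_eq, mul_pow, h.sqrt_two_mul]; ring

theorem g_le_E (h : HighEnergy g E ε W) : 100 * g ≤ E := by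
  have := h.g_le
  nlinarith [h.one_le_sqrt, h.sq_sqrt_E]

theorem small (h : HighEnergy g E ε W) {u : ℝ} (hu : |u| ≤ ε) : |u| ≤ 1 / 100 := hu.trans h.ε_le

theorem radicand_bound (h : HighEnergy g E ε W) (u : ℝ) {w : ℝ} (hw : |w| ≤ W) :
    2 * E - 2 * g - W ^ 2 ≤ 2 * E - 2 * g * cos u - w ^ 2 ∧ E ≤ 2 * E - 2 * g - W ^ 2 := by
  have h1 : w ^ 2 ≤ W ^ 2 := sq_le_sq' (by linarith [abs_le.1 hw]) (by linarith [abs_le.1 hw])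
  have h2 : g * cos u ≤ g * 1 := mul_le_mul_of_nonneg_left (cos_le_one u) h.g_pos.le
  refine ⟨by linarith, ?_⟩
  nlinarith [h.g_le_E, h.W_le, h.W_pos, h.one_le]

theorem speedY_sq (h : HighEnergy g E ε W) (u : ℝ) {w : ℝ} (hw : |w| ≤ W) :
    speedY g E u w ^ 2 = 2 * E - 2 * g * cos u - w ^ 2 :=
  sq_sqrt (by linarith [h.radicand_bound u hw, h.E_pos])

theorem sqrt_le_speedY (h : HighEnergy g E ε W) (u : ℝ) {w : ℝ} (hw : |w| ≤ W) :
    √E ≤ speedY g E u w :=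
  sqrt_le_sqrt (by linarith [h.radicand_bound u hw])

theorem one_le_speedY (h : HighEnergy g E ε W) (u : ℝ) {w : ℝ} (hw : |w| ≤ W) :
    1 ≤ speedY g E u w := h.one_le_sqrt.trans (h.sqrt_le_speedY u hw)

/-- A sharp lower bound of the vertical speed. -/
theorem le_speedY (h : HighEnergy g E ε W) (u : ℝ) {w : ℝ} (hw : |w| ≤ W) :
    √(2 * E) * (1 - 52 / 100 * (g / E)) ≤ speedY g E u w := by
  refine le_sqrt_of_sq_le ?_
  have hx : g / E ≤ 1 / 100 := by
    rw [div_le_iff₀ h.E_pos]; linarith [h.g_le_E]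
  have hx0 : 0 < g / E := div_pos h.g_pos h.E_pos
  have hg : E * (g / E) = g := mul_div_cancel₀ _ h.E_pos.ne'
  rw [mul_pow, h.sqrt_two_mul]
  refine le_trans ?_ (h.radicand_bound u hw).1
  have h1 := h.W_sq
  have h2 := h.sq_le
  have h3 : E * (g / E) ^ 2 = g * (g / E) := by rw [sq, ← mul_assoc, hg]
  have h4 : g * (g / E) ≤ g * (1 / 100) := mul_le_mul_of_nonneg_left hx h.g_pos.le
  nlinarith

/-- A sharp upper bound of the vertical speed. -/
theorem speedY_le (h : HighEnergy g E ε W) {u : ℝ} (hu : |u| ≤ ε) (w : ℝ) :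
    speedY g E u w ≤ √(2 * E) * (1 - 495 / 1000 * (g / E)) := by
  have hx : g / E ≤ 1 / 100 := by
    rw [div_le_iff₀ h.E_pos]; linarith [h.g_le_E]
  have hg : E * (g / E) = g := mul_div_cancel₀ _ h.E_pos.ne'
  refine sqrt_le_iff.2 ⟨mul_nonneg (sqrt_nonneg _) (by linarith), ?_⟩
  rw [mul_pow, h.sqrt_two_mul]
  have h1 := (cos_bounds_of_small (h.small hu)).2
  have h2 := mul_le_mul_of_nonneg_left h1 h.g_pos.le
  nlinarith [sq_nonneg w, mul_nonneg h.E_pos.le (sq_nonneg (g / E))]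

theorem speedY_le_sqrt (h : HighEnergy g E ε W) {u : ℝ} (hu : |u| ≤ ε) (w : ℝ) :
    speedY g E u w ≤ √(2 * E) := by
  refine (h.speedY_le hu w).trans (mul_le_of_le_one_right (sqrt_nonneg _) ?_)
  have : 0 < g / E := div_pos h.g_pos h.E_pos
  linarith

/-- The difference of the squares is controlled by the energy, and the sum of the speeds is at least
`2√E`. -/
theorem abs_speedY_sub_le (h : HighEnergy g E ε W) (u u' : ℝ) {w w' : ℝ} (hw : |w| ≤ W)
    (hw' : |w'| ≤ W) :
    √E * |speedY g E u w - speedY g E u' w'| ≤ g * |u - u'| + W * |w - w'| := by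
  have h1 := h.sqrt_le_speedY u hw
  have h2 := h.sqrt_le_speedY u' hw'
  have e : (speedY g E u w - speedY g E u' w') * (speedY g E u w + speedY g E u' w') =
      2 * g * (cos u' - cos u) + (w' + w) * (w' - w) := by
    linear_combination h.speedY_sq u hw - h.speedY_sq u' hw'
  have h3 : |(speedY g E u w - speedY g E u' w') * (speedY g E u w + speedY g E u' w')| ≤
      2 * (g * |u - u'| + W * |w - w'|) := by
    rw [e]
    refine (abs_add_le _ _).trans ?_
    rw [abs_mul, abs_mul (w' + w), abs_of_pos (by linarith [h.g_pos] : 0 < 2 * g)]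
    have a1 := mul_le_mul_of_nonneg_left (abs_cos_sub_cos_le u' u) h.g_pos.le
    have a2 : |w' + w| ≤ 2 * W := (abs_add_le _ _).trans (by linarith)
    have a3 := mul_le_mul_of_nonneg_right a2 (abs_nonneg (w' - w))
    rw [abs_sub_comm u u', abs_sub_comm w w']
    linarith
  rw [abs_mul, abs_of_pos (by linarith [h.one_le_sqrt] :
    0 < speedY g E u w + speedY g E u' w')] at h3
  nlinarith [abs_nonneg (speedY g E u w - speedY g E u' w')]

/-- The horizontal velocity of a flight depends on the end points like their distance divided by
the flight time. -/
theorem abs_flight_sub_le (h : HighEnergy g E ε W) {ν ν' u u' v v' w w' : ℝ}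
    (hf : IsFlight g E ν u v w) (hf' : IsFlight g E ν' u' v' w') (hw : |w| ≤ W) (hw' : |w'| ≤ W) :
    |(w - w') * (speedY g E u w + speedY g E v w) -
      g * ((ν - ν') * π + (v - v') - (u - u'))| ≤
      1 / 50 * (g * (|u - u'| + |v - v'|) + |w - w'|) := by
  have h1 := h.abs_speedY_sub_le u u' hw hw'
  have h2 := h.abs_speedY_sub_le v v' hw hw'
  -- Subtracting the two flight equations leaves `w'` times the variation of the speeds, which is
  -- small because `|w'| ≤ W ≤ √E / 100`.
  have e : (w - w') * (speedY g E u w + speedY g E v w) -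
      g * ((ν - ν') * π + (v - v') - (u - u')) =
      -(w' * ((speedY g E u w - speedY g E u' w') + (speedY g E v w - speedY g E v' w'))) := by
    rw [IsFlight] at hf hf'
    linear_combination hf - hf'
  rw [e, abs_neg, abs_mul]
  have h3 := abs_add_le (speedY g E u w - speedY g E u' w') (speedY g E v w - speedY g E v' w')
  set X := |speedY g E u w - speedY g E u' w' + (speedY g E v w - speedY g E v' w')|
  have h4 : √E * X ≤ g * (|u - u'| + |v - v'|) + 2 * (W * |w - w'|) := by
    have := mul_le_mul_of_nonneg_left h3 (sqrt_nonneg E)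
    linarith
  have h5 : W ≤ 1 / 100 * √E := by linarith [h.W_le, h.one_le_sqrt]
  have h6 : |w'| * X ≤ 1 / 100 * √E * X :=
    mul_le_mul_of_nonneg_right (hw'.trans h5) (abs_nonneg _)
  have h7 : W * |w - w'| ≤ 1 / 100 * |w - w'| :=
    mul_le_mul_of_nonneg_right (by linarith [h.W_le]) (abs_nonneg _)
  have h8 : 0 ≤ g * (|u - u'| + |v - v'|) := mul_nonneg h.g_pos.le (by positivity)
  linarith [abs_nonneg (w - w')]

/-- If `δ Σ` is close to `D > 0`, then `δ` is positive and at most `D / √E`. -/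
theorem sub_pos_and_le (h : HighEnergy g E ε W) {δ S D : ℝ} (hS : 2 * √E ≤ S) (hD : 0 < D)
    (hb : |δ * S - D| ≤ 1 / 50 * (D + |δ|)) : 0 < δ ∧ √E * δ ≤ D := by
  have h1 := h.one_le_sqrt
  have hb' := abs_le.1 hb
  have hδ : 0 < δ := by
    by_contra hn
    push Not at hn
    rw [abs_of_nonpos hn] at hb'
    nlinarith
  rw [abs_of_pos hδ] at hb'
  exact ⟨hδ, by nlinarith⟩

theorem flight_sub_right (h : HighEnergy g E ε W) {ν u v v' w w' : ℝ}
    (hf : IsFlight g E ν u v w) (hf' : IsFlight g E ν u v' w') (hw : |w| ≤ W) (hw' : |w'| ≤ W)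
    (hv : v' < v) : 0 < w - w' ∧ √E * (w - w') ≤ g * (v - v') := by
  have h1 := h.abs_flight_sub_le hf hf' hw hw'
  refine h.sub_pos_and_le (S := speedY g E u w + speedY g E v w)
    (by linarith [h.sqrt_le_speedY u hw, h.sqrt_le_speedY v hw])
    (mul_pos h.g_pos (sub_pos.2 hv)) ?_
  rw [sub_self, sub_self, zero_mul, zero_add, sub_zero, abs_zero, zero_add,
    abs_of_pos (sub_pos.2 hv)] at h1
  exact h1

theorem flight_sub_left (h : HighEnergy g E ε W) {ν u u' v w w' : ℝ}
    (hf : IsFlight g E ν u v w) (hf' : IsFlight g E ν u' v w') (hw : |w| ≤ W) (hw' : |w'| ≤ W)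
    (hu : u' < u) : 0 < w' - w ∧ √E * (w' - w) ≤ g * (u - u') := by
  have h1 := h.abs_flight_sub_le hf' hf hw' hw
  refine h.sub_pos_and_le (S := speedY g E u' w' + speedY g E v w')
    (by linarith [h.sqrt_le_speedY u' hw', h.sqrt_le_speedY v hw'])
    (mul_pos h.g_pos (sub_pos.2 hu)) ?_
  rw [sub_self, sub_self, zero_mul, zero_add, zero_sub, abs_zero, add_zero, neg_sub,
    abs_sub_comm u' u, abs_of_pos (sub_pos.2 hu)] at h1
  exact h1

/-- Makes the horizontal velocity a function of the two end points. -/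
theorem flight_unique (h : HighEnergy g E ε W) {ν u v w w' : ℝ}
    (hf : IsFlight g E ν u v w) (hf' : IsFlight g E ν u v w') (hw : |w| ≤ W) (hw' : |w'| ≤ W) :
    w = w' := by
  have h1 := h.abs_flight_sub_le hf hf' hw hw'
  simp only [sub_self, zero_mul, add_zero, mul_zero, sub_zero, abs_zero, zero_add, abs_mul] at h1
  have h2 : 2 ≤ |speedY g E u w + speedY g E v w| :=
    le_trans (by linarith [h.one_le_speedY u hw, h.one_le_speedY v hw]) (le_abs_self _)
  have h3 := mul_le_mul_of_nonneg_left h2 (abs_nonneg (w - w'))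
  have h4 : |w - w'| = 0 := le_antisymm (by linarith [abs_nonneg (w - w')]) (abs_nonneg _)
  exact sub_eq_zero.1 (abs_eq_zero.1 h4)

/-- Unlike the previous comparisons it allows different `ν`, so that any flight from `-ε` can be
compared with the one from the corner. -/
theorem flight_le (h : HighEnergy g E ε W) {ν ν' u v v' w w' : ℝ}
    (hf : IsFlight g E ν u v w) (hf' : IsFlight g E ν' u v' w') (hw : |w| ≤ W) (hw' : |w'| ≤ W)
    (hν : ν' ≤ ν) (hv : v' ≤ v) : w' ≤ w := by
  have h1 := h.abs_flight_sub_le hf hf' hw hw'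
  by_contra hn
  push Not at hn
  rw [sub_self, abs_zero, zero_add, sub_zero, abs_of_nonneg (sub_nonneg.2 hv),
    abs_of_neg (by linarith : w - w' < 0)] at h1
  have h2 := h.one_le_speedY u hw
  have h3 := h.one_le_speedY v hw
  have h4 : 0 ≤ g * ((ν - ν') * π) :=
    mul_nonneg h.g_pos.le (mul_nonneg (sub_nonneg.2 hν) pi_pos.le)
  have h5 : 0 ≤ g * (v - v') := mul_nonneg h.g_pos.le (sub_nonneg.2 hv)
  have h6 := (abs_le.1 h1).1
  nlinarith

/-! #### The reflection -/

/-- The factor `reflCos u` is close to 1 and the vertical speed hardly depends on `w`, so the rate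
is close to 1. -/
theorem kick_sub (h : HighEnergy g E ε W) {u : ℝ} (hu : |u| ≤ ε) {w w' : ℝ} (hw : |w| ≤ W)
    (hw' : |w'| ≤ W) (hww : w' ≤ w) :
    1 / 2 * (w - w') ≤ kick g E u w - kick g E u w' ∧
      kick g E u w - kick g E u w' ≤ 2 * (w - w') := by
  have h1 := h.abs_speedY_sub_le u u hw hw'
  rw [sub_self, abs_zero, mul_zero, zero_add, abs_of_nonneg (sub_nonneg.2 hww)] at h1
  have h2 : |speedY g E u w - speedY g E u w'| ≤ 1 / 100 * (w - w') := by
    have := h.one_le_sqrt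
    have := h.W_le
    nlinarith [abs_nonneg (speedY g E u w - speedY g E u w')]
  have h3 : |reflSin u| ≤ 1 := by linarith [abs_reflSin_le u, h.small hu]
  have h4 : |reflSin u * (speedY g E u w - speedY g E u w')| ≤ 1 * (1 / 100 * (w - w')) := by
    rw [abs_mul]
    exact mul_le_mul h3 h2 (abs_nonneg _) zero_le_one
  obtain ⟨-, h5, h6⟩ := reflCos_bounds (h.small hu)
  have e : kick g E u w - kick g E u w' = reflCos u * (w - w') +
      reflSin u * (speedY g E u w - speedY g E u w') := by
    rw [kick, kick]; ring
  rw [e]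
  have h7 := abs_le.1 h4
  constructor <;> nlinarith

/-- Source of the steepness of `Ω`: the variation of `reflSin`, of slope almost 2, is multiplied by
a vertical speed of at least `√E`. The other terms are at most a few hundredths of `u - u'`. -/
theorem kick_neg_sub_left (h : HighEnergy g E ε W) {u u' : ℝ} (hu : |u| ≤ ε) (hu' : |u'| ≤ ε)
    {w w' : ℝ} (hw : |w| ≤ W) (hw' : |w'| ≤ W) (huu : u' < u)
    (hww : |w - w'| * √E ≤ g * (u - u')) :
    √E / 2 * (u - u') ≤ kick g E (-u') w' - kick g E (-u) w := by
  have hσ := h.one_le_sqrt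
  have hΔ : 0 < u - u' := sub_pos.2 huu
  have h0 : |w - w'| ≤ 1 / 100 * (u - u') := by
    have := mul_le_mul_of_nonneg_right h.g_le hΔ.le
    have : √E * |w - w'| ≤ √E * (1 / 100 * (u - u')) := by linarith
    exact le_of_mul_le_mul_left this (by linarith)
  have h1 := h.abs_speedY_sub_le u u' hw hw'
  rw [abs_of_pos hΔ] at h1
  have h2 : |speedY g E u w - speedY g E u' w'| ≤ 1 / 50 * (u - u') := by
    have a1 := mul_le_mul_of_nonneg_right h.g_le hΔ.le
    have a2 : W * |w - w'| ≤ 1 / 100 * (1 / 100 * (u - u')) :=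
      mul_le_mul (by linarith [h.W_le]) h0 (abs_nonneg _) (by norm_num)
    have a3 : √E * |speedY g E u w - speedY g E u' w'| ≤ √E * (1 / 50 * (u - u')) := by
      nlinarith
    exact le_of_mul_le_mul_left a3 (by linarith)
  have e : kick g E (-u') w' - kick g E (-u) w =
      -((reflCos u - reflCos u') * w) - reflCos u' * (w - w') +
      (reflSin u - reflSin u') * speedY g E u w +
      reflSin u' * (speedY g E u w - speedY g E u' w') := by
    rw [kick, kick, reflCos_neg, reflCos_neg, reflSin_neg, reflSin_neg, speedY_neg_left,
      speedY_neg_left]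
    ring
  have b1 : |(reflCos u - reflCos u') * w| ≤ 1 / 10 * (u - u') * (1 / 100) := by
    have := abs_reflCos_sub_le (h.small hu) (h.small hu')
    rw [abs_of_pos hΔ] at this
    rw [abs_mul]
    exact mul_le_mul this (by linarith [h.W_le]) (abs_nonneg _) (by positivity)
  obtain ⟨-, c5, c6⟩ := reflCos_bounds (h.small hu')
  have b2 : |reflCos u' * (w - w')| ≤ 1 * (1 / 100 * (u - u')) := by
    rw [abs_mul, abs_of_pos (by linarith : 0 < reflCos u')]
    exact mul_le_mul c6 h0 (abs_nonneg _) zero_le_one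
  have b3 : (u - u') * √E ≤ (reflSin u - reflSin u') * speedY g E u w :=
    mul_le_mul (by linarith [le_reflSin_sub (h.small hu) (h.small hu') huu.le])
      (h.sqrt_le_speedY u hw) (sqrt_nonneg _) (by linarith [le_reflSin_sub (h.small hu) (h.small hu') huu.le])
  have b4 : |reflSin u' * (speedY g E u w - speedY g E u' w')| ≤ 1 * (1 / 50 * (u - u')) := by
    rw [abs_mul]
    exact mul_le_mul (by linarith [abs_reflSin_le u', h.small hu']) h2 (abs_nonneg _)
      zero_le_one
  rw [e]
  have := abs_le.1 b1
  have := abs_le.1 b2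
  have := abs_le.1 b4
  nlinarith

theorem outgoing_speedY_nonneg (h : HighEnergy g E ε W) {u w : ℝ} (hu : |u| ≤ ε) (hw : |w| ≤ W) :
    0 ≤ reflCos u * speedY g E u w - reflSin u * w := by
  obtain ⟨-, c5, -⟩ := reflCos_bounds (h.small hu)
  have h1 : |reflSin u * w| ≤ 1 * (1 / 100) := by
    rw [abs_mul]
    exact mul_le_mul (by linarith [abs_reflSin_le u, h.small hu])
      (by linarith [h.W_le]) (abs_nonneg _) zero_le_one
  have := abs_le.1 h1
  nlinarith [h.one_le_speedY u hw]

theorem kick_neg_kick (h : HighEnergy g E ε W) {u w : ℝ} (hu : |u| ≤ ε) (hw : |w| ≤ W) :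
    kick g E (-u) (kick g E u w) = w :=
  BouncingCoin.kick_neg_kick (by linarith [h.radicand_bound u hw, h.E_pos])
    (h.outgoing_speedY_nonneg hu hw)

theorem speedY_kick (h : HighEnergy g E ε W) {u w : ℝ} (hu : |u| ≤ ε) (hw : |w| ≤ W) :
    speedY g E u (kick g E u w) = reflCos u * speedY g E u w - reflSin u * w :=
  BouncingCoin.speedY_kick (by linarith [h.radicand_bound u hw, h.E_pos])
    (h.outgoing_speedY_nonneg hu hw)

/-! ### The corner of the rectangle -/

/-- The bounce turns `W` into roughly `W - 2W`. With `x = g/E`, gravity lowers the term `2W` by the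
factor `1 - 0.495 x`, and the cosine costs at most `2ε² ≤ 0.02 x`; altogether `2 · 0.495 - 0.02 =
0.97`. -/
theorem neg_kick_corner_le (h : HighEnergy g E ε W) :
    -kick g E (-ε) W ≤ W * (1 - 97 / 100 * (g / E)) := by
  have hu : |ε| ≤ ε := (abs_of_pos h.ε_pos).le
  have h1 := h.speedY_le hu W
  have h2 := (reflCos_bounds (h.small hu)).1
  have h3 := (le_abs_self _).trans (abs_reflSin_le ε)
  rw [abs_of_pos h.ε_pos] at h3
  have h4 : reflSin ε * speedY g E ε W ≤ 2 * ε * (√(2 * E) * (1 - 495 / 1000 * (g / E))) :=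
    mul_le_mul h3 h1 (sqrt_nonneg _) (by linarith [h.ε_pos])
  have h5 : ε ^ 2 ≤ 1 / 100 * (g / E) := by
    rw [mul_div_assoc', le_div_iff₀ h.E_pos]
    linarith [h.sq_le]
  have h6 := mul_le_mul_of_nonneg_right h2 h.W_pos.le
  have h7 := mul_le_mul_of_nonneg_right h5 h.W_pos.le
  have h8 : 2 * ε * (√(2 * E) * (1 - 495 / 1000 * (g / E))) =
      2 * W * (1 - 495 / 1000 * (g / E)) := by rw [h.W_eq]; ring
  rw [kick, reflCos_neg, reflSin_neg, speedY_neg_left]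
  linarith

theorem div_le (h : HighEnergy g E ε W) : g / E ≤ 1 / 100 := by
  rw [div_le_iff₀ h.E_pos]; linarith [h.g_le_E]

theorem div_pos (h : HighEnergy g E ε W) : 0 < g / E := _root_.div_pos h.g_pos h.E_pos

theorem le_neg_kick_corner (h : HighEnergy g E ε W) :
    8 / 10 * W ≤ -kick g E (-ε) W := by
  have hu : |ε| ≤ ε := (abs_of_pos h.ε_pos).le
  have h1 := h.le_speedY ε (abs_of_pos h.W_pos).le
  have h2 := (reflCos_bounds (h.small hu)).2.2
  have h3 := le_reflSin_sub (h.small hu) (u' := 0) (by norm_num) h.ε_pos.le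
  rw [show reflSin 0 = 0 by simp [reflSin], sub_zero, sub_zero] at h3
  have hx := h.div_le
  have h0 : √(2 * E) * (99 / 100) ≤ √(2 * E) * (1 - 52 / 100 * (g / E)) :=
    mul_le_mul_of_nonneg_left (by linarith) (sqrt_nonneg _)
  have h4 : 19 / 10 * ε * (√(2 * E) * (99 / 100)) ≤ reflSin ε * speedY g E ε W :=
    mul_le_mul h3 (h0.trans h1) (by positivity) (by linarith [h.ε_pos])
  have h6 := mul_le_mul_of_nonneg_right h2 h.W_pos.le
  have h8 : 19 / 10 * ε * (√(2 * E) * (99 / 100)) = 1881 / 1000 * W := by rw [h.W_eq]; ring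
  rw [kick, reflCos_neg, reflSin_neg, speedY_neg_left]
  linarith [h.W_pos]

theorem abs_kick_corner_le (h : HighEnergy g E ε W) : |kick g E (-ε) W| ≤ W := by
  have h1 := h.le_neg_kick_corner
  have h2 := h.neg_kick_corner_le
  have h3 : W * (1 - 97 / 100 * (g / E)) ≤ W :=
    mul_le_of_le_one_right h.W_pos.le (by linarith [h.div_pos])
  rw [abs_of_neg (by linarith [h.W_pos])]
  linarith

/-- A flight with the horizontal velocity `W` passes beyond the neighbouring rectangle. -/
theorem reach (h : HighEnergy g E ε W)
    (hc : IsFlight g E (-1) (-ε) (-ε) (kick g E (-ε) W)) (u v : ℝ) :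
    g * (π + 2 * ε) ≤ W * (speedY g E u W + speedY g E v W) := by
  have hu : |-ε| ≤ ε := by rw [abs_neg]; exact (abs_of_pos h.ε_pos).le
  have hW : |W| ≤ W := (abs_of_pos h.W_pos).le
  have h1 := h.neg_kick_corner_le
  have h2 := h.speedY_le hu (kick g E (-ε) W)
  have hx := h.div_le
  have hx0 := h.div_pos
  have h3 : -kick g E (-ε) W * speedY g E (-ε) (kick g E (-ε) W) ≤
      W * (1 - 97 / 100 * (g / E)) * (√(2 * E) * (1 - 495 / 1000 * (g / E))) :=
    mul_le_mul h1 h2 (sqrt_nonneg _) (mul_nonneg h.W_pos.le (by linarith))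
  have h4 := mul_le_mul_of_nonneg_left (h.le_speedY u hW) h.W_pos.le
  have h5 := mul_le_mul_of_nonneg_left (h.le_speedY v hW) h.W_pos.le
  have h6 : g * (2 * ε) = W * √(2 * E) * (g / E) := by
    rw [h.W_eq, mul_assoc ε, ← sq, h.sqrt_two_mul]
    field_simp [h.E_pos.ne']
  have h7 : 0 < W * √(2 * E) :=
    mul_pos h.W_pos (by linarith [h.one_le_sqrt, h.sqrt_le_sqrt_two_mul])
  rw [IsFlight] at hc
  -- The corner flight loses about `2 (0.97 + 0.495) g/E = 2.93 g/E` against the free value 2. The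
  -- extra distance `2ε` costs only `g/E`, and a flight at velocity `W` loses at most `1.04 g/E`.
  have h8 : W * √(2 * E) * (2 * (1 - 97 / 100 * (g / E)) * (1 - 495 / 1000 * (g / E)) + g / E) ≤
      W * √(2 * E) * (2 * (1 - 52 / 100 * (g / E))) :=
    mul_le_mul_of_nonneg_left (by nlinarith) h7.le
  linarith

/-! ### Existence of the flights and complete crossing of the rectangle. -/

theorem exists_flight (h : HighEnergy g E ε W)
    (hc : IsFlight g E (-1) (-ε) (-ε) (kick g E (-ε) W)) {ν u v : ℝ} (hν : |ν| ≤ 1)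
    (hu : |u| ≤ ε) (hv : |v| ≤ ε) : ∃ w ∈ Icc (-W) W, IsFlight g E ν u v w := by
  have hr := h.reach hc u v
  have hcont : Continuous fun w => w * (speedY g E u w + speedY g E v w) := by
    unfold speedY; fun_prop
  have hd : |ν * π + (v - u)| ≤ π + 2 * ε := by
    refine (abs_add_le _ _).trans (add_le_add ?_ ((abs_sub _ _).trans (by linarith)))
    rw [abs_mul, abs_of_pos pi_pos]
    exact mul_le_of_le_one_left pi_pos.le hν
  have hd' := abs_le.1 hd
  have h1 := mul_le_mul_of_nonneg_left hd'.1 h.g_pos.le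
  have h2 := mul_le_mul_of_nonneg_left hd'.2 h.g_pos.le
  obtain ⟨w, hw, e⟩ := intermediate_value_Icc (by linarith [h.W_pos] : -W ≤ W) hcont.continuousOn
    (show g * (ν * π + (v - u)) ∈ _ by
      simp only [speedY_neg_right]
      constructor <;> linarith)
  exact ⟨w, hw, e⟩

/-- The corner flight is the extreme one, so this flight has a larger `w`. Reversing the bounce at
`-ε` is increasing in `w` and sends the corner velocity to exactly `W`. -/
theorem le_kick_of_flight (h : HighEnergy g E ε W)
    (hc : IsFlight g E (-1) (-ε) (-ε) (kick g E (-ε) W)) {ν v w : ℝ} (hν : -1 ≤ ν)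
    (hv : -ε ≤ v) (hw : |w| ≤ W) (hf : IsFlight g E ν (-ε) v w) : W ≤ kick g E ε w := by
  have h1 := h.flight_le hf hc hw h.abs_kick_corner_le hν hv
  have h2 := (h.kick_sub (abs_of_pos h.ε_pos).le hw h.abs_kick_corner_le h1).1
  have h3 := h.kick_neg_kick (u := -ε) (w := W) (by rw [abs_neg]; exact (abs_of_pos h.ε_pos).le)
    (abs_of_pos h.W_pos).le
  rw [neg_neg] at h3
  linarith

theorem kick_le_of_flight (h : HighEnergy g E ε W)
    (hc : IsFlight g E (-1) (-ε) (-ε) (kick g E (-ε) W)) {ν v w : ℝ} (hν : ν ≤ 1)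
    (hv : v ≤ ε) (hw : |w| ≤ W) (hf : IsFlight g E ν ε v w) : kick g E (-ε) w ≤ -W := by
  have := h.le_kick_of_flight hc (neg_le_neg hν) (neg_le_neg hv) (by rwa [abs_neg]) hf.neg
  have h2 := kick_neg_neg g E (-ε) w
  rw [neg_neg] at h2
  linarith

/-- The image and the preimage of the rectangle, for the flights over `ν` coins. -/
theorem isStrip (h : HighEnergy g E ε W)
    (hc : IsFlight g E (-1) (-ε) (-ε) (kick g E (-ε) W)) {ν : ℝ} (hν : |ν| ≤ 1) :
    IsHorizontalStrip (-ε) ε (-W) W ((2 * g + 2) / √E)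
      {p | p.1 ∈ Icc (-ε) ε ∧ p.2 ∈ Icc (-W) W ∧
        ∃ u ∈ Icc (-ε) ε, kick g E (-u) p.2 ∈ Icc (-W) W ∧ IsFlight g E ν u p.1 p.2} ∧
    IsVerticalStrip (-ε) ε (-W) W ((2 * g + 2) / √E)
      {p | p.1 ∈ Icc (-ε) ε ∧ p.2 ∈ Icc (-W) W ∧ kick g E p.1 p.2 ∈ Icc (-W) W ∧
        ∃ v ∈ Icc (-ε) ε, IsFlight g E ν p.1 v (kick g E p.1 p.2)} := by
  have hσ := h.one_le_sqrt
  have hσ0 : 0 < √E := by linarith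
  have hex : ∀ u v, ∃ w, |u| ≤ ε → |v| ≤ ε → |w| ≤ W ∧ IsFlight g E ν u v w := by
    intro u v
    by_cases hu : |u| ≤ ε
    · by_cases hv : |v| ≤ ε
      · obtain ⟨w, hw, hf⟩ := h.exists_flight hc hν hu hv
        exact ⟨w, fun _ _ => ⟨abs_le.2 hw, hf⟩⟩
      · exact ⟨0, fun _ h => absurd h hv⟩
    · exact ⟨0, fun h => absurd h hu⟩
  choose w hwf using hex
  have hw : ∀ u ∈ Icc (-ε) ε, ∀ v ∈ Icc (-ε) ε, |w u v| ≤ W :=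
    fun u hu v hv => (hwf u v (abs_le.2 hu) (abs_le.2 hv)).1
  have hf : ∀ u ∈ Icc (-ε) ε, ∀ v ∈ Icc (-ε) ε, IsFlight g E ν u v (w u v) :=
    fun u hu v hv => (hwf u v (abs_le.2 hu) (abs_le.2 hv)).2
  have hwu : ∀ u ∈ Icc (-ε) ε, ∀ u' ∈ Icc (-ε) ε, ∀ v ∈ Icc (-ε) ε, u' < u →
      0 < w u' v - w u v ∧ w u' v - w u v ≤ g / √E * (u - u') := by
    intro u hu u' hu' v hv hlt
    have := h.flight_sub_left (hf u hu v hv) (hf u' hu' v hv) (hw u hu v hv) (hw u' hu' v hv) hlt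
    refine ⟨this.1, ?_⟩
    rw [div_mul_eq_mul_div, le_div_iff₀ hσ0]
    linarith [this.2]
  have hwv1 : ∀ u ∈ Icc (-ε) ε, ∀ v ∈ Icc (-ε) ε, ∀ v' ∈ Icc (-ε) ε, v' < v →
      0 < w u v - w u v' ∧ w u v - w u v' ≤ g / √E * (v - v') := by
    intro u hu v hv v' hv' hlt
    have := h.flight_sub_right (hf u hu v hv) (hf u hu v' hv') (hw u hu v hv) (hw u hu v' hv') hlt
    refine ⟨this.1, ?_⟩
    rw [div_mul_eq_mul_div, le_div_iff₀ hσ0]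
    linarith [this.2]
  have hL : 0 ≤ g / √E := by have := h.g_pos; positivity
  have hLs : g / √E ≤ 1 / 100 := by
    rw [div_le_iff₀ hσ0]; linarith [h.g_le]
  have hwu' : ∀ u ∈ Icc (-ε) ε, ∀ u' ∈ Icc (-ε) ε, ∀ v ∈ Icc (-ε) ε,
      |w u v - w u' v| ≤ g / √E * |u - u'| := by
    intro u hu u' hu' v hv
    rcases lt_trichotomy u u' with hlt | hlt | hlt
    · have := hwu u' hu' u hu v hv hlt
      rw [abs_of_neg (by linarith : u - u' < 0), abs_of_pos this.1]
      linarith [this.2]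
    · subst hlt; simp
    · have := hwu u hu u' hu' v hv hlt
      rw [abs_of_pos (by linarith : 0 < u - u'), abs_of_neg (by linarith [this.1])]
      linarith [this.2]
  have hneg : ∀ u ∈ Icc (-ε) ε, |-u| ≤ ε := fun u hu => by rw [abs_neg]; exact abs_le.2 hu
  have hwv : ∀ u ∈ Icc (-ε) ε, ∀ v ∈ Icc (-ε) ε, ∀ v' ∈ Icc (-ε) ε,
      |w u v - w u v'| ≤ g / √E * |v - v'| := by
    intro u hu v hv v' hv'
    rcases lt_trichotomy v v' with hlt | hlt | hlt
    · have := hwv1 u hu v' hv' v hv hlt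
      rw [abs_of_neg (by linarith : v - v' < 0), abs_of_neg (by linarith [this.1])]
      linarith [this.2]
    · subst hlt; simp
    · have := hwv1 u hu v hv v' hv' hlt
      rw [abs_of_pos (by linarith : 0 < v - v'), abs_of_pos this.1]
      linarith [this.2]
  have hΩu : ∀ u ∈ Icc (-ε) ε, ∀ u' ∈ Icc (-ε) ε, ∀ v ∈ Icc (-ε) ε, u' < u →
      √E / 2 * (u - u') ≤ kick g E (-u') (w u' v) - kick g E (-u) (w u v) := by
    intro u hu u' hu' v hv hlt
    refine h.kick_neg_sub_left (abs_le.2 hu) (abs_le.2 hu') (hw u hu v hv) (hw u' hu' v hv) hlt ?_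
    have := hwu' u hu u' hu' v hv
    rw [div_mul_eq_mul_div, le_div_iff₀ hσ0, abs_of_pos (sub_pos.2 hlt)] at this
    exact this
  have hΩc : ∀ v ∈ Icc (-ε) ε,
      ContinuousOn (fun u => kick g E (-u) (w u v)) (Icc (-ε) ε) := by
    intro v hv
    have hcw : ContinuousOn (fun u => w u v) (Icc (-ε) ε) := by
      have : LipschitzOnWith (g / √E).toNNReal (fun u => w u v) (Icc (-ε) ε) := by
        refine LipschitzOnWith.of_dist_le_mul fun a ha b hb => ?_
        rw [Real.dist_eq, Real.dist_eq, Real.coe_toNNReal _ hL]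
        exact hwu' a ha b hb v hv
      exact this.continuousOn
    have hp : ContinuousOn (fun u => ((-u, w u v) : ℝ × ℝ)) (Icc (-ε) ε) :=
      continuous_neg.continuousOn.prodMk hcw
    have hk := (continuous_kick g E).comp_continuousOn hp
    exact hk
  have hΩv : ∀ u ∈ Icc (-ε) ε, ∀ v ∈ Icc (-ε) ε, ∀ v' ∈ Icc (-ε) ε, v' < v →
      0 < kick g E (-u) (w u v) - kick g E (-u) (w u v') ∧
      kick g E (-u) (w u v) - kick g E (-u) (w u v') ≤ √E / 2 * (v - v') := by
    intro u hu v hv v' hv' hlt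
    have h1 := hwv1 u hu v hv v' hv' hlt
    have h2 := h.kick_sub (hneg u hu) (hw u hu v hv) (hw u hu v' hv') (by linarith [h1.1])
    have h3 := mul_le_mul_of_nonneg_right hLs (by linarith : 0 ≤ v - v')
    have h4 := mul_le_mul_of_nonneg_right hσ (by linarith : 0 ≤ v - v')
    exact ⟨by linarith [h1.1], by linarith [h1.2]⟩
  have hlo : ∀ v ∈ Icc (-ε) ε, W ≤ kick g E (- -ε) (w (-ε) v) := by
    intro v hv
    simp only [neg_neg]
    have hm : -ε ∈ Icc (-ε) ε := ⟨le_rfl, by linarith [h.ε_pos]⟩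
    exact h.le_kick_of_flight hc (abs_le.1 hν).1 hv.1 (hw _ hm v hv) (hf _ hm v hv)
  have hhi : ∀ v ∈ Icc (-ε) ε, kick g E (-ε) (w ε v) ≤ -W := by
    intro v hv
    have hm : ε ∈ Icc (-ε) ε := ⟨by linarith [h.ε_pos], le_rfl⟩
    exact h.kick_le_of_flight hc (abs_le.1 hν).2 hv.2 (hw _ hm v hv) (hf _ hm v hv)
  -- The numerator `2g + 2` covers both requirements on `μ`: `2L = 2g/√E` and `1/m = 2/√E`.
  have key := exists_strips (ε := ε) (W := W) (L := g / √E) (m := √E / 2)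
    (μ := (2 * g + 2) / √E) (w := w) (Ω := fun u v => kick g E (-u) (w u v)) h.ε_pos h.W_pos
    hL (by linarith) (by rw [mul_div_assoc']; gcongr; linarith)
    (by field_simp; linarith [h.g_pos])
    (fun u hu v hv => abs_le.1 (hw u hu v hv)) hwu hwv hΩu hΩc hΩv hlo hhi
  convert key using 2
  · ext ⟨v, y⟩
    simp only [mem_ofPred_eq]
    refine and_congr_right fun hv => ⟨?_, ?_⟩
    · rintro ⟨hy, u, hu, hk, hfl⟩
      have := h.flight_unique (hf u hu v hv) hfl (hw u hu v hv) (abs_le.2 hy)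
      exact ⟨u, hu, by rwa [this], this⟩
    · rintro ⟨u, hu, hk, rfl⟩
      exact ⟨abs_le.1 (hw u hu v hv), u, hu, hk, hf u hu v hv⟩
  · ext ⟨u, ω⟩
    simp only [mem_ofPred_eq]
    refine and_congr_right fun hu => and_congr_right fun hω => ⟨?_, ?_⟩
    · rintro ⟨hy, v, hv, hfl⟩
      have := h.flight_unique (hf u hu v hv) hfl (hw u hu v hv) (abs_le.2 hy)
      exact ⟨v, hv, by rw [this]; exact h.kick_neg_kick (abs_le.2 hu) (abs_le.2 hω)⟩
    · rintro ⟨v, hv, rfl⟩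
      have := h.kick_neg_kick (hneg u hu) (hw u hu v hv)
      rw [neg_neg] at this
      rw [this]
      exact ⟨abs_le.1 (hw u hu v hv), v, hv, hf u hu v hv⟩

/-- The size of the rectangle: `2 k = W √(2E)` is close to `g π / 2`. -/
theorem size_bounds (h : HighEnergy g E ε W) :
    14 / 10 * (W * √(2 * E)) ≤
        -kick g E (-ε) W * (2 * speedY g E (-ε) (kick g E (-ε) W)) ∧
      -kick g E (-ε) W * (2 * speedY g E (-ε) (kick g E (-ε) W)) ≤ 2 * (W * √(2 * E)) := by
  have hu : |-ε| ≤ ε := by rw [abs_neg]; exact (abs_of_pos h.ε_pos).le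
  have h1 := h.le_neg_kick_corner
  have h2 := abs_le.1 h.abs_kick_corner_le
  have h3 := h.speedY_le_sqrt hu (kick g E (-ε) W)
  have h4 := h.le_speedY (-ε) h.abs_kick_corner_le
  have h0 : √(2 * E) * (99 / 100) ≤ √(2 * E) * (1 - 52 / 100 * (g / E)) :=
    mul_le_mul_of_nonneg_left (by linarith [h.div_le]) (sqrt_nonneg _)
  have h5 : 8 / 10 * W * (√(2 * E) * (99 / 100)) ≤
      -kick g E (-ε) W * speedY g E (-ε) (kick g E (-ε) W) :=
    mul_le_mul h1 (h0.trans h4) (by positivity) (by linarith [h.W_pos])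
  have h6 : -kick g E (-ε) W * speedY g E (-ε) (kick g E (-ε) W) ≤ W * √(2 * E) :=
    mul_le_mul (by linarith) h3 (sqrt_nonneg _) h.W_pos.le
  have h7 : 0 < W * √(2 * E) :=
    mul_pos h.W_pos (by linarith [h.one_le_sqrt, h.sqrt_le_sqrt_two_mul])
  constructor <;> linarith

end HighEnergy

section

/-! ### The flights of the billiard -/

variable {g E : ℝ} {p q : ℝ × ℝ}

theorem vyOut_sq (hp : p ∈ phaseSpace g E) :
    vyOut g E p ^ 2 = 2 * E - 2 * g * |sin p.1| - vθOut g E p ^ 2 := by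
  obtain ⟨hs, hE, -⟩ := hp
  have h1 : vyIn g E p ^ 2 = 2 * E - 2 * g * |sin p.1| - p.2 ^ 2 := by
    rw [vyIn, neg_sq, sq_sqrt hE.le]
  have h2 : (sin p.1 / |sin p.1|) ^ 2 = 1 := by
    rw [div_pow, sq_abs, div_self (pow_ne_zero 2 hs)]
  have h0 : 1 + cos p.1 ^ 2 ≠ 0 := by positivity
  have h3 : sin p.1 ^ 2 = 1 - cos p.1 ^ 2 := by linarith [sin_sq_add_cos_sq p.1]
  have e : vyOut g E p ^ 2 + vθOut g E p ^ 2 = p.2 ^ 2 + vyIn g E p ^ 2 := by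
    rw [vyOut, vθOut, h3]
    generalize sin p.1 / |sin p.1| = σ at h2 ⊢
    field_simp
    linear_combination (4 * cos p.1 ^ 2 * (p.2 ^ 2 + vyIn g E p ^ 2)) * h2
  linarith

/-- The mirror reflection is an involution. -/
theorem vθIn_eq (hp : p ∈ phaseSpace g E) :
    p.2 = (sin p.1 ^ 2 * vθOut g E p + 2 * cos p.1 * (sin p.1 / |sin p.1|) * vyOut g E p) /
      (1 + cos p.1 ^ 2) := by
  have hs := hp.1
  have h2 : (sin p.1 / |sin p.1|) ^ 2 = 1 := by
    rw [div_pow, sq_abs, div_self (pow_ne_zero 2 hs)]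
  have h0 : 1 + cos p.1 ^ 2 ≠ 0 := by positivity
  have h3 : sin p.1 ^ 2 = 1 - cos p.1 ^ 2 := by linarith [sin_sq_add_cos_sq p.1]
  rw [vyOut, vθOut, h3]
  generalize sin p.1 / |sin p.1| = σ at h2 ⊢
  field_simp
  linear_combination (-4 * cos p.1 ^ 2 * p.2) * h2

/-- The reflected velocity points into the table. -/
theorem outgoing (hp : p ∈ phaseSpace g E) :
    0 < vyOut g E p - cos p.1 * (sin p.1 / |sin p.1|) * vθOut g E p := by
  have hs := hp.1
  have h2 : (sin p.1 / |sin p.1|) ^ 2 = 1 := by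
    rw [div_pow, sq_abs, div_self (pow_ne_zero 2 hs)]
  have h0 : 1 + cos p.1 ^ 2 ≠ 0 := by positivity
  have h3 : sin p.1 ^ 2 = 1 - cos p.1 ^ 2 := by linarith [sin_sq_add_cos_sq p.1]
  have e : vyOut g E p - cos p.1 * (sin p.1 / |sin p.1|) * vθOut g E p =
      -(-(cos p.1 * (sin p.1 / |sin p.1|)) * p.2 + vyIn g E p) := by
    rw [vyOut, vθOut, h3]
    generalize sin p.1 / |sin p.1| = σ at h2 ⊢
    field_simp
    linear_combination (-2 * cos p.1 ^ 2 * vyIn g E p) * h2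
  rw [e]
  exact neg_pos.2 hp.2.2

theorem continuous_gap (g E : ℝ) (p : ℝ × ℝ) :
    Continuous fun t => flightY g E p t - |sin (flightθ g E p t)| := by
  unfold flightY flightθ; fun_prop

/-- Right after the reflection the point is above the boundary. -/
theorem exists_gap_pos (hp : p ∈ phaseSpace g E) :
    ∃ δ > 0, ∀ t, 0 < t → t < δ → |sin (flightθ g E p t)| < flightY g E p t := by
  have hs := hp.1
  have hd : HasDerivAt (fun t => flightY g E p t - |sin (flightθ g E p t)|)
      (vyOut g E p - cos p.1 * (sin p.1 / |sin p.1|) * vθOut g E p) 0 := by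
    have h1 : HasDerivAt (fun t => flightY g E p t) (vyOut g E p) 0 := by
      have a1 : HasDerivAt (fun t : ℝ => |sin p.1| + vyOut g E p * t - g * t ^ 2 / 2)
          (vyOut g E p * 1 - g * (2 * 0 ^ 1 * 1) / 2) 0 := by
        exact (((hasDerivAt_id (0 : ℝ)).const_mul _).const_add _).sub
          ((((hasDerivAt_id (0 : ℝ)).pow 2).const_mul g).div_const 2)
      exact a1.congr_deriv (by ring)
    have h2 : HasDerivAt (fun t => flightθ g E p t) (vθOut g E p) 0 := by
      have := ((hasDerivAt_id (0 : ℝ)).const_mul (vθOut g E p)).const_add p.1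
      rw [mul_one] at this
      exact this
    have h0 : flightθ g E p 0 = p.1 := by simp [flightθ]
    have h3 := h2.sin
    rw [h0] at h3
    have h4 : HasDerivAt (fun x : ℝ => |x|) (sin p.1 / |sin p.1|) (sin (flightθ g E p 0)) := by
      rw [h0]
      convert hasDerivAt_abs hs using 1
      rcases lt_or_gt_of_ne hs with h | h
      · rw [abs_of_neg h, sign_neg h, div_neg, div_self hs]; simp
      · rw [abs_of_pos h, sign_pos h, div_self hs]; simp
    have h5 := h4.comp (0 : ℝ) h3
    have h6 := h1.sub h5
    exact h6.congr_deriv (by ring)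
  have hev := hd.tendsto_slope.eventually (lt_mem_nhds (outgoing hp))
  rw [eventually_nhdsWithin_iff, Metric.eventually_nhds_iff] at hev
  obtain ⟨δ, hδ, hδ'⟩ := hev
  refine ⟨δ, hδ, fun t ht htδ => ?_⟩
  have := hδ' (show dist t 0 < δ by rwa [dist_zero_right, norm_of_nonneg ht.le]) ht.ne'
  rw [slope_def_field] at this
  have h0 : flightY g E p 0 - |sin (flightθ g E p 0)| = 0 := by simp [flightY, flightθ]
  rw [h0, sub_zero, sub_zero] at this
  have := (div_pos_iff_of_pos_right ht).1 this
  linarith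

/-! ### The first return time. -/

theorem flightTime_spec (hg : 0 < g) (hp : p ∈ phaseSpace g E) :
    0 < flightTime g E p ∧
      flightY g E p (flightTime g E p) = |sin (flightθ g E p (flightTime g E p))| ∧
      ∀ t, 0 < t → t < flightTime g E p → |sin (flightθ g E p t)| < flightY g E p t := by
  obtain ⟨δ, hδ, hpos⟩ := exists_gap_pos hp
  have hcont := continuous_gap g E p
  set Z := {t : ℝ | 0 < t ∧ flightY g E p t = |sin (flightθ g E p t)|} with hZ
  have hbdd : BddBelow Z := ⟨0, fun t ht => ht.1.le⟩
  have hzero : ∀ s t, 0 < s → s < t → |sin (flightθ g E p s)| < flightY g E p s →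
      flightY g E p t ≤ |sin (flightθ g E p t)| → ∃ r ∈ Z, r ≤ t := by
    intro s t hs hst h1 h2
    obtain ⟨r, hr, h⟩ := intermediate_value_Icc' hst.le hcont.continuousOn
      (show (0 : ℝ) ∈ _ from ⟨sub_nonpos.2 h2, (sub_pos.2 h1).le⟩)
    exact ⟨r, ⟨hs.trans_le hr.1, sub_eq_zero.1 h⟩, hr.2⟩
  have hne : Z.Nonempty := by
    -- Late enough for the parabola to be below height 0: here `t ≥ 1` and `g t / 2 ≥ |vyOut| + 1`,
    -- while the initial height is at most 1.
    set t := δ + 2 * (|vyOut g E p| + 1) / g + 1 with ht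
    have ha := abs_nonneg (vyOut g E p)
    have h3 : 0 < 2 * (|vyOut g E p| + 1) / g := by positivity
    have h4 : g * t / 2 ≥ |vyOut g E p| + 1 := by
      have h5 : g * (2 * (|vyOut g E p| + 1) / g) = 2 * (|vyOut g E p| + 1) :=
        mul_div_cancel₀ _ hg.ne'
      have h6 : 0 < g * (δ + 1) := by positivity
      have h7 : g * t = g * (δ + 1) + g * (2 * (|vyOut g E p| + 1) / g) := by rw [ht]; ring
      linarith
    have h5 : flightY g E p t ≤ |sin (flightθ g E p t)| := by
      refine le_trans ?_ (abs_nonneg _)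
      rw [flightY]
      have h6 := abs_sin_le_one p.1
      have h7 := le_abs_self (vyOut g E p)
      have h8 : 1 ≤ t := by linarith
      nlinarith
    obtain ⟨r, hr, -⟩ := hzero (δ / 2) t (by linarith) (by linarith)
      (hpos _ (by linarith) (by linarith)) h5
    exact ⟨r, hr⟩
  have hmem : sInf Z ∈ Z := by
    -- There is no contact before `δ`, so the open condition `0 < t` can be replaced by a closed one
    -- and the infimum is attained.
    have e : Z = Ici δ ∩ {t | flightY g E p t - |sin (flightθ g E p t)| = 0} := by
      ext t
      constructor
      · rintro ⟨h1, h2⟩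
        refine ⟨?_, sub_eq_zero.2 h2⟩
        by_contra h
        have := hpos t h1 (not_le.1 h)
        linarith
      · rintro ⟨h1, h2⟩
        exact ⟨hδ.trans_le h1, sub_eq_zero.1 h2⟩
    have hcl : IsClosed Z := by
      rw [e]
      exact isClosed_Ici.inter (isClosed_eq hcont continuous_const)
    exact hcl.csInf_mem hne hbdd
  refine ⟨hmem.1, hmem.2, fun t ht htT => ?_⟩
  by_contra h
  rw [not_lt] at h
  have hm : 0 < min (δ / 2) (t / 2) := lt_min (by linarith) (by linarith)
  obtain ⟨r, hr, hrt⟩ := hzero (min (δ / 2) (t / 2)) t hm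
    ((min_le_right _ _).trans_lt (by linarith))
    (hpos _ hm ((min_le_left _ _).trans_lt (by linarith))) h
  exact absurd (csInf_le hbdd hr) (not_le.2 (hrt.trans_lt htT))

theorem abs_abs_sin_sub_le (x y : ℝ) : |(|sin x| - |sin y|)| ≤ |x - y| :=
  (abs_abs_sub_abs_le _ _).trans (abs_sin_sub_sin_le x y)

theorem abs_flight_sub (g E : ℝ) (p : ℝ × ℝ) (s t : ℝ) :
    |(|sin (flightθ g E p s)| - |sin (flightθ g E p t)|)| ≤ |vθOut g E p| * |s - t| := by
  refine (abs_abs_sin_sub_le _ _).trans (le_of_eq ?_)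
  rw [← abs_mul, flightθ, flightθ]
  congr 1
  ring

/-- The next collision happens about when the flight is back at its initial height. -/
theorem abs_time_sub_le {t : ℝ} (ht : 0 < t)
    (h : flightY g E p t = |sin (flightθ g E p t)|) :
    |g * t / 2 - vyOut g E p| ≤ |vθOut g E p| := by
  have h1 := abs_flight_sub g E p 0 t
  have h0 : flightθ g E p 0 = p.1 := by simp [flightθ]
  have e : |sin p.1| - flightY g E p t = t * (g * t / 2 - vyOut g E p) := by
    rw [flightY]; ring
  rw [h0, ← h, e, zero_sub, abs_neg, abs_mul, mul_comm, abs_of_pos ht] at h1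
  exact le_of_mul_le_mul_right h1 ht

/-- Each contact time satisfies `g t / 2 ≥ vyOut - |vθOut|`. Two of them would satisfy `g (s + t) /
2 ≤ vyOut + |vθOut|`, because `|sin|` is 1-Lipschitz; this is where the factor 3 comes from. -/
theorem flightTime_eq (hv : 3 * |vθOut g E p| < vyOut g E p) {t : ℝ} (ht : 0 < t)
    (h : flightY g E p t = |sin (flightθ g E p t)|) : flightTime g E p = t := by
  have huniq : ∀ s t, 0 < s → s < t → flightY g E p s = |sin (flightθ g E p s)| →
      flightY g E p t = |sin (flightθ g E p t)| → False := by
    intro s t hs hst h1 h2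
    have a1 := (abs_le.1 (abs_time_sub_le hs h1)).1
    have a2 := (abs_le.1 (abs_time_sub_le (hs.trans hst) h2)).1
    have a3 := abs_flight_sub g E p s t
    have e : flightY g E p s - flightY g E p t =
        (t - s) * (g * s / 2 + g * t / 2 - vyOut g E p) := by
      rw [flightY, flightY]; ring
    rw [← h1, ← h2, e, abs_sub_comm s t, abs_mul, mul_comm, abs_of_pos (sub_pos.2 hst)] at a3
    have a4 := le_of_mul_le_mul_right a3 (sub_pos.2 hst)
    have a5 := le_abs_self (g * s / 2 + g * t / 2 - vyOut g E p)
    linarith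
  have : {t : ℝ | 0 < t ∧ flightY g E p t = |sin (flightθ g E p t)|} = {t} := by
    ext s
    constructor
    · rintro ⟨h1, h2⟩
      rcases lt_trichotomy s t with hst | hst | hst
      · exact (huniq s t h1 hst h2 h).elim
      · exact hst
      · exact (huniq t s ht hst h h2).elim
    · rintro rfl
      exact ⟨ht, h⟩
  rw [flightTime, this, csInf_singleton]

/-- The vertical velocity at the landing, if the landing is steep enough. -/
theorem landing (hg : 0 < g) (hp : p ∈ phaseSpace g E)
    (h : 2 * (returnMap g E p).2 ^ 2 < 2 * E - 2 * g * |sin (returnMap g E p).1|) :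
    vyOut g E p - g * flightTime g E p = vyIn g E (returnMap g E p) := by
  obtain ⟨hT, hy, hpos⟩ := flightTime_spec hg hp
  set T := flightTime g E p
  have hz : returnMap g E p = (flightθ g E p T, vθOut g E p) := rfl
  have hsq : (vyOut g E p - g * T) ^ 2 =
      2 * E - 2 * g * |sin (flightθ g E p T)| - vθOut g E p ^ 2 := by
    rw [← hy, flightY]
    linear_combination vyOut_sq hp
  -- Before `T` the point is above the boundary, whose height varies at rate at most `|vθOut|`, so
  -- it cannot arrive with a larger upward velocity. The steepness hypothesis then excludes the
  -- range from 0 to `|vθOut|`.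
  have hle : vyOut g E p - g * T ≤ |vθOut g E p| := by
    have hlt : ∀ t, 0 < t → t < T → vyOut g E p - g * (T + t) / 2 ≤ |vθOut g E p| := by
      intro t ht htT
      have h1 := (abs_le.1 (abs_flight_sub g E p T t)).2
      have h2 := hpos t ht htT
      have e : flightY g E p T - flightY g E p t =
          (T - t) * (vyOut g E p - g * (T + t) / 2) := by
        rw [flightY, flightY]; ring
      rw [abs_of_pos (sub_pos.2 htT)] at h1
      have h3 : (T - t) * (vyOut g E p - g * (T + t) / 2) ≤ (T - t) * |vθOut g E p| := by linarith
      exact le_of_mul_le_mul_left h3 (sub_pos.2 htT)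
    by_contra hn
    push Not at hn
    set d := vyOut g E p - g * T - |vθOut g E p| with hd
    have hd0 : 0 < d := by linarith
    have := hlt (T / 2) (by linarith) (by linarith)
    have : 0 < g * T := mul_pos hg hT
    linarith
  rw [hz] at h
  simp only at h
  have hneg : vyOut g E p - g * T < 0 := by
    by_contra hn
    push Not at hn
    have h1 : (vyOut g E p - g * T) ^ 2 ≤ |vθOut g E p| ^ 2 := pow_le_pow_left₀ hn hle 2
    rw [sq_abs] at h1
    linarith
  rw [hz, vyIn]
  simp only
  rw [← hsq, sqrt_sq_eq_abs, abs_of_neg hneg, neg_neg]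

/-- A collision is determined by the next one. -/
theorem returnMap_injective (hg : 0 < g) (hp : p ∈ phaseSpace g E) (hq : q ∈ phaseSpace g E)
    (he : returnMap g E p = returnMap g E q)
    (h : 2 * (returnMap g E p).2 ^ 2 < 2 * E - 2 * g * |sin (returnMap g E p).1|) : p = q := by
  wlog hle : flightTime g E p ≤ flightTime g E q generalizing p q
  · exact (this hq hp he.symm (he ▸ h) (not_le.1 hle).le).symm
  have lp := landing hg hp h
  have lq := landing hg hq (he ▸ h)
  rw [← he] at lq
  obtain ⟨-, yp, -⟩ := flightTime_spec hg hp
  obtain ⟨-, yq, hpos⟩ := flightTime_spec hg hq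
  have hp0 := flightTime_spec hg hp |>.1
  have e1 : flightθ g E p (flightTime g E p) = flightθ g E q (flightTime g E q) :=
    congrArg Prod.fst he
  have e2 : vθOut g E p = vθOut g E q := congrArg Prod.snd he
  set T := flightTime g E p
  set T' := flightTime g E q
  have eT : T = T' := by
    by_contra hne
    -- Both flights share their final motion. Running it back for the time `T` would put the longer
    -- flight on the boundary, at the foot point of `p`, before its landing.
    have hlt : T < T' := lt_of_le_of_ne hle hne
    have h1 := hpos (T' - T) (sub_pos.2 hlt) (by linarith)
    have e3 : flightθ g E q (T' - T) = p.1 := by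
      simp only [flightθ] at e1 ⊢
      rw [← e2] at e1 ⊢
      linarith
    have e4 : flightY g E q (T' - T) = |sin p.1| := by
      rw [e1, ← yq] at yp
      simp only [flightY] at yp ⊢
      linear_combination -yp - T * lq + T * lp
    rw [e3, e4] at h1
    exact lt_irrefl _ h1
  have e3 : p.1 = q.1 := by
    simp only [flightθ] at e1
    rw [← e2, ← eT] at e1
    linarith
  have e4 : vyOut g E p = vyOut g E q := by
    rw [← eT] at lq
    linarith
  have e5 : p.2 = q.2 := by
    rw [vθIn_eq hp, vθIn_eq hq, e2, e3, e4]
  exact Prod.ext e3 e5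

end

section

/-! ### The billiard near the tops of the coins -/

variable {g E ε W : ℝ}

theorem sin_top (m : ℤ) (u : ℝ) : sin (π / 2 + m * π + u) = (-1) ^ m * cos u := by
  rw [show π / 2 + m * π + u = u + π / 2 + m * π by ring, sin_add_int_mul_pi, sin_add_pi_div_two]

theorem cos_top (m : ℤ) (u : ℝ) : cos (π / 2 + m * π + u) = -((-1) ^ m * sin u) := by
  rw [show π / 2 + m * π + u = u + π / 2 + m * π by ring, cos_add_int_mul_pi, cos_add_pi_div_two,
    mul_neg]

theorem abs_sin_top (m : ℤ) {u : ℝ} (hu : 0 < cos u) : |sin (π / 2 + m * π + u)| = cos u := by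
  rw [sin_top, abs_mul, abs_neg_one_zpow, one_mul, abs_of_pos hu]

theorem slope_top (m : ℤ) {u : ℝ} (hu : 0 < cos u) :
    cos (π / 2 + m * π + u) * (sin (π / 2 + m * π + u) / |sin (π / 2 + m * π + u)|) = -sin u := by
  rw [abs_sin_top m hu, sin_top, cos_top, mul_div_assoc, div_self hu.ne']
  rcases Int.even_or_odd m with h | h
  · rw [h.neg_one_zpow]; ring
  · rw [h.neg_one_zpow]; ring

theorem sin_sq_top (m : ℤ) (u : ℝ) : sin (π / 2 + m * π + u) ^ 2 = cos u ^ 2 := by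
  rw [sin_top]
  rcases Int.even_or_odd m with h | h
  · rw [h.neg_one_zpow]; ring
  · rw [h.neg_one_zpow]; ring

theorem cos_sq_top (m : ℤ) (u : ℝ) : cos (π / 2 + m * π + u) ^ 2 = sin u ^ 2 := by
  linarith [sin_sq_add_cos_sq (π / 2 + m * π + u), sin_sq_top m u, sin_sq_add_cos_sq u]

theorem vyIn_top (g E : ℝ) (m : ℤ) {u : ℝ} (hu : 0 < cos u) (ω : ℝ) :
    vyIn g E (π / 2 + m * π + u, ω) = -speedY g E u ω := by
  simp only [vyIn, abs_sin_top m hu, speedY]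

theorem vθOut_top (g E : ℝ) (m : ℤ) {u : ℝ} (hu : 0 < cos u) (ω : ℝ) :
    vθOut g E (π / 2 + m * π + u, ω) = kick g E u ω := by
  rw [vθOut, vyIn_top g E m hu]
  simp only
  rw [mul_assoc (2 : ℝ), slope_top m hu, sin_sq_top, cos_sq_top, kick, reflCos, reflSin]
  ring

theorem vyOut_top (g E : ℝ) (m : ℤ) {u : ℝ} (hu : 0 < cos u) (ω : ℝ) :
    vyOut g E (π / 2 + m * π + u, ω) = reflCos u * speedY g E u ω - reflSin u * ω := by
  rw [vyOut, vyIn_top g E m hu]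
  simp only
  rw [mul_assoc (2 : ℝ), slope_top m hu, sin_sq_top, cos_sq_top, reflCos, reflSin]
  ring

namespace HighEnergy

theorem cos_pos (h : HighEnergy g E ε W) {u : ℝ} (hu : |u| ≤ ε) : 0 < cos u := by
  linarith [(cos_bounds_of_small (h.small hu)).2]

theorem mem_phaseSpace (h : HighEnergy g E ε W) (m : ℤ) {u ω : ℝ} (hu : |u| ≤ ε) (hω : |ω| ≤ W) :
    (π / 2 + m * π + u, ω) ∈ phaseSpace g E := by
  have hc := h.cos_pos hu
  refine ⟨?_, ?_, ?_⟩
  · rw [← abs_pos, abs_sin_top m hc]; exact hc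
  · simp only [abs_sin_top m hc]
    linarith [h.radicand_bound u hω, h.E_pos]
  · simp only [slope_top m hc, vyIn_top g E m hc, neg_neg]
    have h1 : |sin u * ω| ≤ 1 * (1 / 100) := by
      rw [abs_mul]
      exact mul_le_mul (abs_sin_le_one u) (by linarith [h.W_le]) (abs_nonneg _) zero_le_one
    linarith [(abs_le.1 h1).2, h.one_le_speedY u hω]

/-- Bridge between billiard and model: energy at the landing fixes the vertical speed up to sign,
and the flight is steep enough for this contact to be the first one. -/
theorem returnMap_eq_iff (h : HighEnergy g E ε W) (m n : ℤ) {u ω v w : ℝ} (hu : |u| ≤ ε)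
    (hω : |ω| ≤ W) (hv : |v| ≤ ε) (hw : |w| ≤ W) :
    returnMap g E (π / 2 + m * π + u, ω) = (π / 2 + (m + n) * π + v, w) ↔
      kick g E u ω = w ∧ IsFlight g E n u v w := by
  have hcu := h.cos_pos hu
  have hcv := h.cos_pos hv
  have hg := h.g_pos
  have hθ := vθOut_top g E m hcu ω
  have hV : kick g E u ω = w → vyOut g E (π / 2 + m * π + u, ω) = speedY g E u w := by
    rintro rfl
    rw [vyOut_top g E m hcu, h.speedY_kick hu hω]
  have hcast : ((m + n : ℤ) : ℝ) = m + n := by push_cast; rfl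
  have hsv := abs_sin_top (m + n) hcv
  rw [hcast] at hsv
  have su := h.speedY_sq u hw
  have sv := h.speedY_sq v hw
  constructor
  · intro he
    have e1 : flightθ g E (π / 2 + m * π + u, ω) (flightTime g E (π / 2 + m * π + u, ω)) =
      π / 2 + (m + n) * π + v := congrArg Prod.fst he
    have e2 : vθOut g E (π / 2 + m * π + u, ω) = w := congrArg Prod.snd he
    obtain ⟨hT, hy, -⟩ := flightTime_spec hg (h.mem_phaseSpace m hu hω)
    have hk := hθ.symm.trans e2
    refine ⟨hk, ?_⟩
    have ht := abs_time_sub_le hT hy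
    rw [hV hk, e2] at ht
    rw [e1, hsv, flightY, abs_sin_top m hcu, hV hk] at hy
    rw [flightθ, e2] at e1
    simp only at e1
    set T := flightTime g E (π / 2 + m * π + u, ω)
    -- The contact time is about `2 speedY / g`, so the point is descending; this selects the sign
    -- of the square root.
    have hpos : 0 < g * T - speedY g E u w := by
      have := (abs_le.1 ht).1
      linarith [h.one_le_speedY u hw, h.W_le]
    have e3 : g * T - speedY g E u w = speedY g E v w := by
      refine (pow_left_inj₀ hpos.le (by linarith [h.one_le_speedY v hw]) two_ne_zero).1 ?_
      linear_combination su - sv - 2 * g * hy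
    rw [IsFlight, ← e3]
    linear_combination g * e1
  · rintro ⟨hk, hf⟩
    have e2 := hθ.trans hk
    have hS : 0 < speedY g E u w + speedY g E v w := by
      linarith [h.one_le_speedY u hw, h.one_le_speedY v hw]
    set T := (speedY g E u w + speedY g E v w) / g with hT
    have hT0 : 0 < T := _root_.div_pos hS hg
    have hgT : g * T = speedY g E u w + speedY g E v w := mul_div_cancel₀ _ hg.ne'
    have e1 : flightθ g E (π / 2 + m * π + u, ω) T = π / 2 + (m + n) * π + v := by
      rw [flightθ, e2]
      simp only
      rw [IsFlight, ← hgT] at hf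
      have : w * T = n * π + (v - u) := mul_left_cancel₀ hg.ne' (by linarith)
      linarith
    have hy : flightY g E (π / 2 + m * π + u, ω) T =
        |sin (flightθ g E (π / 2 + m * π + u, ω) T)| := by
      rw [e1, hsv, flightY, abs_sin_top m hcu, hV hk]
      refine mul_left_cancel₀ (mul_ne_zero two_ne_zero hg.ne') ?_
      linear_combination (speedY g E u w - speedY g E v w - g * T) * hgT - sv + su
    have hft := flightTime_eq (p := (π / 2 + m * π + u, ω))
      (by rw [e2, hV hk]; linarith [h.one_le_speedY u hw, h.W_le]) hT0 hy
    rw [returnMap, hft, e1, e2]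

/-- Supplies the hypothesis of `returnMap_injective` at every landing in a rectangle. -/
theorem steep (h : HighEnergy g E ε W) {z : ℝ × ℝ} (hz : |z.2| ≤ W) :
    2 * z.2 ^ 2 < 2 * E - 2 * g * |sin z.1| := by
  have h1 : z.2 ^ 2 ≤ W ^ 2 := sq_le_sq' (by linarith [abs_le.1 hz]) (by linarith [abs_le.1 hz])
  have h2 : g * |sin z.1| ≤ g * 1 := mul_le_mul_of_nonneg_left (abs_sin_le_one _) h.g_pos.le
  have h3 : W ^ 2 ≤ 1 / 100 := by nlinarith [h.W_le, h.W_pos]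
  linarith [h.g_le_E, h.one_le]

/-- A flight of moderate horizontal velocity passes over at most one coin. -/
theorem abs_disp_le (h : HighEnergy g E ε W)
    (hc : IsFlight g E (-1) (-ε) (-ε) (kick g E (-ε) W)) {n : ℤ} {u v w : ℝ} (hu : |u| ≤ ε)
    (hv : |v| ≤ ε) (hw : |w| ≤ W) (hf : IsFlight g E n u v w) : |n| ≤ 1 := by
  have h1 : |w * (speedY g E u w + speedY g E v w)| ≤ W * (2 * √(2 * E)) := by
    rw [abs_mul]
    refine mul_le_mul hw ?_ (abs_nonneg _) h.W_pos.le
    rw [abs_of_pos (by linarith [h.one_le_speedY u hw, h.one_le_speedY v hw])]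
    linarith [h.speedY_le_sqrt hu w, h.speedY_le_sqrt hv w]
  rw [IsFlight] at hf hc
  have h2 := h.size_bounds.1
  have h3 : W * (2 * √(2 * E)) ≤ g * (15 / 10 * π) := by
    have : 0 < g * π := mul_pos h.g_pos pi_pos
    linarith
  rw [hf, abs_mul, abs_of_pos h.g_pos] at h1
  have h4 : |(n : ℝ) * π + (v - u)| ≤ 15 / 10 * π :=
    le_of_mul_le_mul_left (h1.trans h3) h.g_pos
  have h5 : |v - u| ≤ 2 / 100 := (abs_sub _ _).trans (by linarith [h.ε_le])
  have h6 := abs_add_le ((n : ℝ) * π + (v - u)) (-(v - u))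
  rw [add_neg_cancel_right, abs_neg, abs_mul, abs_of_pos pi_pos] at h6
  have h7 : |(n : ℝ)| * π < 2 * π := by linarith [pi_gt_three]
  have h8 : |(n : ℝ)| < 2 := lt_of_mul_lt_mul_right h7 pi_pos.le
  have h9 : |n| < 2 := by exact_mod_cast h8
  omega

end HighEnergy

/-! ### The cylinder -/

theorem proj_eq_iff {p q : ℝ × ℝ} : proj p = proj q ↔ ∃ j : ℤ, p = (q.1 + 2 * π * j, q.2) := by
  rw [proj, proj, Prod.mk.injEq, Real.Angle.angle_eq_iff_two_pi_dvd_sub]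
  constructor
  · rintro ⟨⟨j, hj⟩, h⟩
    exact ⟨j, Prod.ext (by simp only; linarith) h⟩
  · rintro ⟨j, rfl⟩
    exact ⟨⟨j, by ring⟩, rfl⟩

theorem phaseSpace_add_int {p : ℝ × ℝ} (hp : p ∈ phaseSpace g E) (j : ℤ) :
    (p.1 + j * (2 * π), p.2) ∈ phaseSpace g E := by
  have : vyIn g E (p.1 + j * (2 * π), p.2) = vyIn g E p := by
    simp [vyIn, Real.sin_add_int_mul_two_pi]
  simpa only [phaseSpace, mem_ofPred_eq, Real.sin_add_int_mul_two_pi,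
    Real.cos_add_int_mul_two_pi, this] using hp

theorem proj_returnMap_injective (hg : 0 < g) {p q : ℝ × ℝ} (hp : p ∈ phaseSpace g E)
    (hq : q ∈ phaseSpace g E) (he : proj (returnMap g E p) = proj (returnMap g E q))
    (h : 2 * (returnMap g E p).2 ^ 2 < 2 * E - 2 * g * |sin (returnMap g E p).1|) :
    proj p = proj q := by
  obtain ⟨j, hj⟩ := proj_eq_iff.1 he
  have h1 := returnMap_add_int g E q.1 q.2 j
  have h2 : p = (q.1 + j * (2 * π), q.2) := by
    refine returnMap_injective hg hp (phaseSpace_add_int hq j) ?_ h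
    rw [hj, h1]
    exact Prod.ext (by simp only; ring) rfl
  exact proj_eq_iff.2 ⟨j, by rw [h2]; exact Prod.ext (by simp only; ring) rfl⟩

end

section

variable {g E k : ℝ}

/-! ### The size of the rectangles -/

theorem exists_highEnergy (hg : 0 < g) (K : ℝ) :
    ∃ E₀ : ℝ, 0 < E₀ ∧ ∀ E, E₀ ≤ E → ∀ k, 0 < k → k ≤ K →
      HighEnergy g E (k / E) (√2 * k / √E) := by
  -- The four summands yield in turn `one_le`, `g_le`, `W_le` and `sq_le`.
  refine ⟨1 + (100 * g) ^ 2 + (200 * K) ^ 2 + 100 * K ^ 2 / g, by positivity, ?_⟩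
  intro E hE k hk hkK
  have h1 : 0 ≤ 100 * K ^ 2 / g := by positivity
  have hE1 : 1 ≤ E := by nlinarith [sq_nonneg (100 * g), sq_nonneg (200 * K)]
  have hE0 : 0 < E := by linarith
  have hs : 0 < √E := sqrt_pos.2 hE0
  have h100 : 100 * g ≤ √E := le_sqrt_of_sq_le (by nlinarith [sq_nonneg (200 * K)])
  have h200 : 200 * K ≤ √E := le_sqrt_of_sq_le (by nlinarith [sq_nonneg (100 * g)])
  have h2 : √2 ≤ 2 := sqrt_le_iff.2 ⟨by norm_num, by norm_num⟩
  refine ⟨hg, by positivity, hE1, ?_, h100, ?_, ?_⟩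
  · have h3 : √E * √E = E := mul_self_sqrt hE0.le
    rw [sqrt_mul zero_le_two, div_mul_eq_mul_div, div_eq_div_iff hs.ne' hE0.ne']
    linear_combination (-√2 * k) * h3
  · rw [mul_div_assoc', div_le_one hs]
    nlinarith
  · have h3 : k ^ 2 ≤ K ^ 2 := pow_le_pow_left₀ hk.le hkK 2
    have h4 : 100 * K ^ 2 / g ≤ E := by nlinarith [sq_nonneg (100 * g), sq_nonneg (200 * K)]
    rw [div_le_iff₀ hg] at h4
    have h5 : E * (k / E) ^ 2 = k ^ 2 / E := by field_simp
    rw [h5, mul_div_assoc', div_le_iff₀ hE0]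
    linarith

theorem cornerEq_eq (h : HighEnergy g E (k / E) (√2 * k / √E)) :
    cornerEq g E k = 2 / g * (kick g E (-(k / E)) (√2 * k / √E) *
      speedY g E (-(k / E)) (kick g E (-(k / E)) (√2 * k / √E))) + π := by
  have hc : 0 < cos (-(k / E)) :=
    h.cos_pos (by rw [abs_neg]; exact (abs_of_pos h.ε_pos).le)
  have e : π / 2 - k / E = π / 2 + (0 : ℤ) * π + -(k / E) := by push_cast; ring
  simp only [cornerEq, e, vθOut_top g E 0 hc, abs_sin_top 0 hc, speedY]

theorem isFlight_of_cornerEq (h : HighEnergy g E (k / E) (√2 * k / √E))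
    (hk : cornerEq g E k = 0) :
    IsFlight g E (-1) (-(k / E)) (-(k / E)) (kick g E (-(k / E)) (√2 * k / √E)) := by
  rw [cornerEq_eq h] at hk
  have hg := h.g_pos.ne'
  rw [IsFlight]
  generalize kick g E (-(k / E)) (√2 * k / √E) = w at hk ⊢
  generalize speedY g E (-(k / E)) w = S at hk ⊢
  field_simp at hk
  linear_combination hk

/-- Since `W √(2E) = 2k`, `size_bounds` places `-2F(k)` between `2.8 k` and `4 k`, and the equation
requires the value `g π`. At `k = gπ/8` it is at most `gπ/2`, at `k = gπ/2` at least `1.4 gπ`. -/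
theorem exists_cornerEq_eq_zero (hg : 0 < g) :
    ∃ E₀ : ℝ, ∀ E : ℝ, E₀ ≤ E →
      ∃ k : ℝ, g * π / 8 < k ∧ k < g * π / 2 ∧ cornerEq g E k = 0 := by
  obtain ⟨E₀, -, hE₀⟩ := exists_highEnergy hg (g * π / 2)
  refine ⟨E₀, fun E hE => ?_⟩
  have hgπ : 0 < g * π := mul_pos hg pi_pos
  set F : ℝ → ℝ := fun k => kick g E (-(k / E)) (√2 * k / √E) *
      speedY g E (-(k / E)) (kick g E (-(k / E)) (√2 * k / √E)) with hF
  have hcont : Continuous F := by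
    have h1 : Continuous fun k : ℝ => ((-(k / E), √2 * k / √E) : ℝ × ℝ) := by fun_prop
    have h2 := (continuous_kick g E).comp h1
    have h3 : Continuous fun k : ℝ =>
        ((-(k / E), kick g E (-(k / E)) (√2 * k / √E)) : ℝ × ℝ) :=
      (continuous_id.div_const E).neg.prodMk h2
    have h4 := (continuous_speedY g E).comp h3
    have h5 := h2.mul h4
    exact h5
  have hb : ∀ k, 0 < k → k ≤ g * π / 2 → -4 * k ≤ 2 * F k ∧ 2 * F k ≤ -(28 / 10) * k := by
    intro k hk hk'
    have h := hE₀ E hE k hk hk'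
    have h1 := h.size_bounds
    have h2 : √2 * k / √E * √(2 * E) = 2 * k := by
      have h3 : √2 * √2 = 2 := mul_self_sqrt zero_le_two
      have h4 : √E ≠ 0 := (sqrt_pos.2 h.E_pos).ne'
      rw [sqrt_mul zero_le_two]
      field_simp
      linear_combination h3
    rw [h2] at h1
    simp only [hF]
    constructor <;> linarith [h1.1, h1.2]
  have ha := hb (g * π / 8) (by linarith) (by linarith)
  have hb' := hb (g * π / 2) (by linarith) le_rfl
  obtain ⟨k, hk, hFk⟩ := intermediate_value_Icc' (by linarith : g * π / 8 ≤ g * π / 2)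
    hcont.continuousOn (show -(g * π / 2) ∈ _ by constructor <;> linarith)
  have hne : k ≠ g * π / 8 := by rintro rfl; linarith
  have hne' : k ≠ g * π / 2 := by rintro rfl; linarith
  refine ⟨k, lt_of_le_of_ne hk.1 hne.symm, lt_of_le_of_ne hk.2 hne', ?_⟩
  rw [cornerEq_eq (hE₀ E hE k (by linarith [hk.1]) hk.2)]
  have e : kick g E (-(k / E)) (√2 * k / √E) *
      speedY g E (-(k / E)) (kick g E (-(k / E)) (√2 * k / √E)) = -(g * π / 2) := hFk
  rw [e]
  field_simp
  ring

/-! ### Coins and displacements -/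

/-- The number of the coin. -/
def Side.idx : Side → ℤ
  | .L => 0
  | .R => 1

theorem Side.center_eq (σ : Side) : σ.center = π / 2 + σ.idx * π := by
  cases σ <;> simp only [Side.center, Side.idx] <;> push_cast <;> ring

/-- The number of coins between the two collisions. -/
def Label.disp (s : Label) : ℤ := s.target.idx + 2 * s.shift - s.source.idx

theorem Label.abs_disp (s : Label) : |s.disp| ≤ 1 := by
  cases s <;> decide

theorem Label.ext_of_source_disp {s t : Label} (h : s.source = t.source) (h' : s.disp = t.disp) :
    s = t := by
  cases s <;> cases t <;>
    first | rfl | (simp [Label.source] at h; done) | exact absurd h' (by decide)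

/-- The parity of the displacement decides whether the side changes, so each source has one label
for each of the displacements `-1, 0, 1`. -/
theorem Label.exists_of_disp (σ τ : Side) (j : ℤ) (h : |τ.idx + 2 * j - σ.idx| ≤ 1) :
    ∃ s : Label, s.source = σ ∧ s.target = τ ∧ s.shift = j := by
  rw [abs_le] at h
  rcases σ with _ | _ <;> rcases τ with _ | _ <;> simp only [Side.idx] at h
  · obtain rfl : j = 0 := by omega
    exact ⟨.L2, rfl, rfl, rfl⟩
  · obtain rfl | rfl : j = 0 ∨ j = -1 := by omega
    · exact ⟨.R1, rfl, rfl, rfl⟩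
    · exact ⟨.R3, rfl, rfl, rfl⟩
  · obtain rfl | rfl : j = 0 ∨ j = 1 := by omega
    · exact ⟨.L3, rfl, rfl, rfl⟩
    · exact ⟨.L1, rfl, rfl, rfl⟩
  · obtain rfl : j = 0 := by omega
    exact ⟨.R2, rfl, rfl, rfl⟩

theorem eq_zero_of_abs_mul_pi_lt {i : ℤ} (h : |(i : ℝ) * π| < π) : i = 0 := by
  rw [abs_mul, abs_of_pos pi_pos] at h
  have h1 : |(i : ℝ)| < 1 := lt_of_mul_lt_mul_right (by linarith) pi_pos.le
  have h2 : |i| < 1 := by exact_mod_cast h1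
  exact Int.abs_lt_one_iff.1 h2

/-- At high energy the phase space conditions hold automatically, so the rectangles are full. -/
theorem mem_rect_iff (h : HighEnergy g E (k / E) (√2 * k / √E)) {σ : Side} {p : ℝ × ℝ} :
    p ∈ rect g E k σ ↔ |p.1 - σ.center| ≤ k / E ∧ |p.2| ≤ √2 * k / √E := by
  refine ⟨fun hp => hp.2, fun hp => ⟨?_, hp⟩⟩
  have := h.mem_phaseSpace σ.idx hp.1 hp.2
  rwa [← Side.center_eq, add_sub_cancel] at this

theorem returnMap_iff (h : HighEnergy g E (k / E) (√2 * k / √E)) {σ τ : Side} {j : ℤ}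
    {p q : ℝ × ℝ} (hp : p ∈ rect g E k σ) (hq : q ∈ rect g E k τ) :
    returnMap g E p = (q.1 + 2 * π * j, q.2) ↔
      kick g E (p.1 - σ.center) p.2 = q.2 ∧
        IsFlight g E ((τ.idx + 2 * j - σ.idx : ℤ) : ℝ) (p.1 - σ.center) (q.1 - τ.center) q.2 := by
  rw [← h.returnMap_eq_iff σ.idx _ hp.2.1 hp.2.2 hq.2.1 hq.2.2, ← Side.center_eq, add_sub_cancel,
    Side.center_eq τ]
  have e : π / 2 + ((σ.idx : ℝ) + ((τ.idx + 2 * j - σ.idx : ℤ) : ℝ)) * π +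
      (q.1 - (π / 2 + τ.idx * π)) = q.1 + 2 * π * j := by push_cast; ring
  rw [e]

/-! ### The strips -/

/-- The strip `H_s` on the universal cover. -/
def liftH (g E k : ℝ) (s : Label) : Set (ℝ × ℝ) :=
  {q | q ∈ rect g E k s.target ∧
    ∃ p ∈ rect g E k s.source, returnMap g E p = (q.1 + 2 * π * s.shift, q.2)}

/-- The strip `V_s` on the universal cover. -/
def liftV (g E k : ℝ) (s : Label) : Set (ℝ × ℝ) :=
  {p | p ∈ rect g E k s.source ∧
    ∃ q ∈ rect g E k s.target, returnMap g E p = (q.1 + 2 * π * s.shift, q.2)}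

theorem mem_stripH_iff {s : Label} {x : Real.Angle × ℝ} :
    x ∈ stripH g E k s ↔ ∃ p ∈ liftV g E k s, proj (returnMap g E p) = x := by
  constructor
  · rintro ⟨_, ⟨⟨p, hp, rfl⟩, hq⟩, rfl⟩
    exact ⟨p, ⟨hp, _, hq, Prod.ext (by simp only; ring) rfl⟩, rfl⟩
  · rintro ⟨p, ⟨hp, q, hq, he⟩, rfl⟩
    refine ⟨_, ⟨⟨p, hp, rfl⟩, ?_⟩, rfl⟩
    rw [he]
    simpa only [add_sub_cancel_right] using hq

theorem stripH_eq (s : Label) : stripH g E k s = proj '' liftH g E k s := by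
  ext x
  rw [mem_stripH_iff]
  constructor
  · rintro ⟨p, ⟨hp, q, hq, he⟩, rfl⟩
    exact ⟨q, ⟨hq, p, hp, he⟩, (proj_eq_iff.2 ⟨s.shift, he⟩).symm⟩
  · rintro ⟨q, ⟨hq, p, hp, he⟩, rfl⟩
    exact ⟨p, ⟨hp, q, hq, he⟩, proj_eq_iff.2 ⟨s.shift, he⟩⟩

theorem proj_eq_of_returnMap (h : HighEnergy g E (k / E) (√2 * k / √E)) {s : Label}
    {p q : ℝ × ℝ} (hp : p ∈ liftV g E k s) (hq : q ∈ phaseSpace g E)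
    (he : proj (returnMap g E p) = proj (returnMap g E q)) : proj p = proj q := by
  obtain ⟨hp, r, hr, e⟩ := hp
  refine proj_returnMap_injective h.g_pos hp.1 hq he (h.steep ?_)
  rw [e]
  exact hr.2.2

/-- A preimage could a priori lie anywhere in the phase space; injectivity forces it into the source
rectangle. -/
theorem stripV_eq (h : HighEnergy g E (k / E) (√2 * k / √E)) (s : Label) :
    stripV g E k s = proj '' liftV g E k s := by
  ext x
  constructor
  · rintro ⟨⟨q, hq, rfl⟩, hx⟩
    rw [returnMapCyl_proj, mem_stripH_iff] at hx
    obtain ⟨p, hp, he⟩ := hx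
    exact ⟨p, hp, proj_eq_of_returnMap h hp hq he⟩
  · rintro ⟨p, hp, rfl⟩
    refine ⟨⟨p, hp.1.1, rfl⟩, ?_⟩
    rw [returnMapCyl_proj, mem_stripH_iff]
    exact ⟨p, hp, rfl⟩

theorem eq_of_proj_eq (h : HighEnergy g E (k / E) (√2 * k / √E)) {σ τ : Side} {p q : ℝ × ℝ}
    (hp : p ∈ rect g E k σ) (hq : q ∈ rect g E k τ) (he : proj p = proj q) : σ = τ ∧ p = q := by
  obtain ⟨j, rfl⟩ := proj_eq_iff.1 he
  have h1 := hp.2.1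
  have h2 := hq.2.1
  simp only [Side.center_eq] at h1 h2
  have h3 : σ.idx - τ.idx - 2 * j = 0 := by
    refine eq_zero_of_abs_mul_pi_lt ?_
    have e : ((σ.idx - τ.idx - 2 * j : ℤ) : ℝ) * π = q.1 - (π / 2 + τ.idx * π) -
        (q.1 + 2 * π * j - (π / 2 + σ.idx * π)) := by push_cast; ring
    rw [e]
    refine (abs_sub _ _).trans_lt ?_
    linarith [h.ε_le, pi_gt_three]
  have h4 : σ = τ ∧ j = 0 := by
    rcases σ with _ | _ <;> rcases τ with _ | _ <;> simp only [Side.idx] at h3 <;>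
      simp <;> omega
  refine ⟨h4.1, ?_⟩
  rw [h4.2]
  simp

/-- A common point has one landing point on the cover; two different displacements would separate
the possible landings by about `π`, far more than the width of a rectangle. -/
theorem disjoint_stripV (h : HighEnergy g E (k / E) (√2 * k / √E)) {s t : Label} (hst : s ≠ t) :
    Disjoint (stripV g E k s) (stripV g E k t) := by
  rw [stripV_eq h, stripV_eq h, Set.disjoint_left]
  rintro _ ⟨p, ⟨hp, q, hq, e⟩, rfl⟩ ⟨p', ⟨hp', q', hq', e'⟩, hpp⟩
  obtain ⟨hσ, rfl⟩ := eq_of_proj_eq h hp' hp hpp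
  have e1 : q.1 + 2 * π * s.shift = q'.1 + 2 * π * t.shift :=
    congrArg Prod.fst (e.symm.trans e')
  refine hst (Label.ext_of_source_disp hσ.symm (sub_eq_zero.1 (eq_zero_of_abs_mul_pi_lt ?_)))
  have e2 : ((s.disp - t.disp : ℤ) : ℝ) * π =
      (q'.1 - t.target.center) - (q.1 - s.target.center) := by
    rw [Label.disp, Label.disp, hσ, Side.center_eq, Side.center_eq]
    push_cast
    linear_combination e1
  rw [e2]
  refine (abs_sub _ _).trans_lt ?_
  linarith [h.ε_le, pi_gt_three, hq.2.1, hq'.2.1]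

/-- The image of the domain meets the domain exactly in the six strips. -/
theorem iUnion_stripH (h : HighEnergy g E (k / E) (√2 * k / √E)) (hk : cornerEq g E k = 0) :
    (⋃ s : Label, stripH g E k s) =
      returnMapCyl g E '' domainCyl g E k ∩ domainCyl g E k := by
  have hdom : ∀ (σ : Side) (p : ℝ × ℝ), p ∈ rect g E k σ → proj p ∈ domainCyl g E k := by
    rintro (_ | _) p hp
    · exact Or.inl ⟨p, hp, rfl⟩
    · exact Or.inr ⟨p, hp, rfl⟩
  have hdom' : ∀ x ∈ domainCyl g E k, ∃ (σ : Side) (p : ℝ × ℝ), p ∈ rect g E k σ ∧ proj p = x := by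
    rintro x (⟨p, hp, rfl⟩ | ⟨p, hp, rfl⟩)
    · exact ⟨.L, p, hp, rfl⟩
    · exact ⟨.R, p, hp, rfl⟩
  ext x
  rw [mem_iUnion]
  constructor
  · rintro ⟨s, hx⟩
    rw [mem_stripH_iff] at hx
    obtain ⟨p, ⟨hp, q, hq, he⟩, rfl⟩ := hx
    refine ⟨⟨proj p, hdom _ p hp, returnMapCyl_proj g E p⟩, ?_⟩
    rw [proj_eq_iff.2 ⟨s.shift, he⟩]
    exact hdom _ q hq
  · rintro ⟨⟨y, hy, rfl⟩, hx⟩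
    obtain ⟨σ, p, hp, rfl⟩ := hdom' y hy
    rw [returnMapCyl_proj] at hx ⊢
    obtain ⟨τ, q, hq, e⟩ := hdom' _ hx
    obtain ⟨j, hj⟩ := proj_eq_iff.1 e.symm
    obtain ⟨-, hf⟩ := (returnMap_iff h hp hq).1 hj
    -- The only use of the corner equation here: it keeps `W` too small to pass two coins.
    have hn := h.abs_disp_le (isFlight_of_cornerEq h hk) hp.2.1 hq.2.1 hq.2.2 hf
    obtain ⟨s, rfl, rfl, rfl⟩ := Label.exists_of_disp σ τ j hn
    exact ⟨s, mem_stripH_iff.2 ⟨p, ⟨hp, q, hq, hj⟩, rfl⟩⟩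

/-- By injectivity a common point would have a single preimage, lying in two of the disjoint sets
`stripV`. -/
theorem disjoint_stripH (h : HighEnergy g E (k / E) (√2 * k / √E)) {s t : Label} (hst : s ≠ t) :
    Disjoint (stripH g E k s) (stripH g E k t) := by
  rw [Set.disjoint_left]
  intro x hs ht
  obtain ⟨p, hp, rfl⟩ := mem_stripH_iff.1 hs
  obtain ⟨q, hq, he⟩ := mem_stripH_iff.1 ht
  have e := proj_eq_of_returnMap h hp hq.1.1 he.symm
  exact Set.disjoint_left.1 (disjoint_stripV h hst)
    (show proj p ∈ stripV g E k s by rw [stripV_eq h]; exact ⟨p, hp, rfl⟩)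
    (by rw [stripV_eq h, e]; exact ⟨q, hq, rfl⟩)

theorem isStripIn_stripH_stripV (h : HighEnergy g E (k / E) (√2 * k / √E)) (hk : cornerEq g E k = 0)
    (s : Label) :
    IsHorizontalStripIn E k s.target ((2 * g + 2) / √E) (stripH g E k s) ∧
      IsVerticalStripIn E k s.source ((2 * g + 2) / √E) (stripV g E k s) := by
  have hν : |((s.disp : ℤ) : ℝ)| ≤ 1 := by exact_mod_cast s.abs_disp
  obtain ⟨hH, hV⟩ := h.isStrip (isFlight_of_cornerEq h hk) hν
  have hH' := hH.translate s.target.center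
  have hV' := hV.translate s.source.center
  rw [← sub_eq_add_neg] at hH' hV'
  refine ⟨⟨_, hH', ?_⟩, ⟨_, hV', ?_⟩⟩
  · rw [stripH_eq]
    congr 1
    ext q
    simp only [mem_ofPred_eq, mem_Icc, ← abs_le]
    constructor
    · rintro ⟨hq, p, hp, he⟩
      obtain ⟨hkick, hf⟩ := (returnMap_iff h hp hq).1 he
      refine ⟨hq.2.1, hq.2.2, p.1 - s.source.center, hp.2.1, ?_, hf⟩
      rw [← hkick, h.kick_neg_kick hp.2.1 hp.2.2]
      exact hp.2.2
    · rintro ⟨hq1, hq2, u, hu, hω, hf⟩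
      have hq := (mem_rect_iff h).2 ⟨hq1, hq2⟩
      have hp : (s.source.center + u, kick g E (-u) q.2) ∈ rect g E k s.source :=
        (mem_rect_iff h).2 ⟨by simpa using hu, hω⟩
      refine ⟨hq, _, hp, (returnMap_iff h hp hq).2 ?_⟩
      simp only [add_sub_cancel_left]
      refine ⟨?_, hf⟩
      have := h.kick_neg_kick (u := -u) (by rwa [abs_neg]) hq2
      rwa [neg_neg] at this
  · rw [stripV_eq h]
    congr 1
    ext p
    simp only [mem_ofPred_eq, mem_Icc, ← abs_le]
    constructor
    · rintro ⟨hp, q, hq, he⟩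
      obtain ⟨hkick, hf⟩ := (returnMap_iff h hp hq).1 he
      rw [hkick]
      exact ⟨hp.2.1, hp.2.2, hq.2.2, q.1 - s.target.center, hq.2.1, hf⟩
    · rintro ⟨hp1, hp2, hω, v, hv, hf⟩
      have hp := (mem_rect_iff h).2 ⟨hp1, hp2⟩
      have hq : (s.target.center + v, kick g E (p.1 - s.source.center) p.2) ∈
          rect g E k s.target :=
        (mem_rect_iff h).2 ⟨by simpa using hv, hω⟩
      refine ⟨hp, _, hq, (returnMap_iff h hp hq).2 ⟨rfl, ?_⟩⟩
      simp only [add_sub_cancel_left]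
      exact hf

theorem stripV_subset (h : HighEnergy g E (k / E) (√2 * k / √E)) (s : Label) :
    stripV g E k s ⊆ domainCyl g E k := by
  rw [stripV_eq h]
  rintro _ ⟨p, hp, rfl⟩
  have hp := hp.1
  rcases hs : s.source with _ | _ <;> rw [hs] at hp
  · exact Or.inl ⟨p, hp, rfl⟩
  · exact Or.inr ⟨p, hp, rfl⟩

end

end BouncingCoin

end

/-! ### Assembly of the proposition. -/

theorem proposition5p2 (g : ℝ) (hg : 0 < g) :
    (∃ E₀ : ℝ, ∀ E : ℝ, E₀ ≤ E →
      ∃ k : ℝ, g * π / 8 < k ∧ k < g * π / 2 ∧ BouncingCoin.cornerEq g E k = 0) ∧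
    ∀ k₁ k₂ : ℝ, 0 < k₁ →
      ∃ C E₀ : ℝ, 0 < C ∧ 0 < E₀ ∧ ∀ E : ℝ, E₀ ≤ E →
        ∀ k : ℝ, k₁ < k → k < k₂ → BouncingCoin.cornerEq g E k = 0 →
          ((⋃ s : BouncingCoin.Label, BouncingCoin.stripH g E k s) =
              BouncingCoin.returnMapCyl g E '' BouncingCoin.domainCyl g E k ∩
                BouncingCoin.domainCyl g E k ∧
            (∀ s t : BouncingCoin.Label, s ≠ t →
              Disjoint (BouncingCoin.stripH g E k s) (BouncingCoin.stripH g E k t)) ∧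
            ∀ s : BouncingCoin.Label,
              BouncingCoin.IsHorizontalStripIn E k s.target (C / √E)
                (BouncingCoin.stripH g E k s)) ∧
          ((∀ s t : BouncingCoin.Label, s ≠ t →
              Disjoint (BouncingCoin.stripV g E k s) (BouncingCoin.stripV g E k t)) ∧
            ∀ s : BouncingCoin.Label,
              BouncingCoin.stripV g E k s ⊆ BouncingCoin.domainCyl g E k ∧
              BouncingCoin.IsVerticalStripIn E k s.source (C / √E)
                (BouncingCoin.stripV g E k s)) := by
  refine ⟨BouncingCoin.exists_cornerEq_eq_zero hg, fun k₁ k₂ hk₁ => ?_⟩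
  obtain ⟨E₀, hE₀, hhigh⟩ := BouncingCoin.exists_highEnergy hg k₂
  -- The constant `C` is the numerator found in `isStrip`. The threshold depends on `k₂` only; `k₁`
  -- serves to make `k` positive.
  refine ⟨2 * g + 2, E₀, by linarith, hE₀, fun E hE k hk hk' hc => ?_⟩
  have h := hhigh E hE k (hk₁.trans hk) hk'.le
  exact ⟨⟨BouncingCoin.iUnion_stripH h hc, fun s t => BouncingCoin.disjoint_stripH h,
      fun s => (BouncingCoin.isStripIn_stripH_stripV h hc s).1⟩,
    fun s t => BouncingCoin.disjoint_stripV h,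
    fun s => ⟨BouncingCoin.stripV_subset h s, (BouncingCoin.isStripIn_stripH_stripV h hc s).2⟩⟩
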